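/- **Setting.** Let $F$ be the distribution function of a probability law on $[0,1]$ and $F^{-1}(q)=\inf\{v\in[0,1]:F(v)\ge q\}$. For $\beta\ge 0$ and $\varepsilon_0\in(0,1]$, $F$ is *$(\beta,\varepsilon_0)$-clustered with gap quantiles* $0=q_0^\star<q_1^\star<\dots<q_n^\star<q_{n+1}^\star=1$ ($n\ge 0$) if for every $i\in\{1,\dots,n+1\}$: (a) $|F^{-1}(q)-F^{-1}(\tilde q)|\le|q-\tilde q|^{1/(\beta+1)}$ for all $q,\tilde q\in(q_{i-1}^\star,q_i^\star]$; (b) $q_i^\star-q_{i-1}^\star\ge\varepsilon_0$. Candidates with i.i.d. abilities $\theta_1,\dots,\theta_T\sim F$ arrive one by one; each must be irrevocably hired or rejected on arrival, and at most $B$ may be hired. For an online policy hiring the (random) set $S\subseteq\{1,\dots,T\}$, the regret is $$\mathrm{Regret}(B,T)=\mathbb E\Big[\max_{A\subseteq\{1,\dots,T\},\,|A|\le B}\ \sum_{t\in A}\theta_t\Big]-\mathbb E\Big[\sum_{t\in S}\theta_t\Big].$$ **The CwG policy** (inputs $T$, $B$, $F$, $\varepsilon_0$ and the gap quantiles). Put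 $B_0=B$ and $\tilde T=\max\{0,\,T-\lfloor 16\log(1/\varepsilon_0)/\varepsilon_0^2\rfloor\}$. For $t=1,\dots,\tilde T$ let $\tau=T-t+1$ and $p^{\mathrm{ce}}_{t-1}=1-B_{t-1}/\tau$, and let $\mathcal S_{t-1}$ be the set of $i\in\{1,\dots,n\}$ with $|p^{\mathrm{ce}}_{t-1}-q_i^\star|<\sqrt{2\log(\tau)/\tau}$. The threshold is $p_{t-1}=p^{\mathrm{ce}}_{t-1}$ if $\mathcal S_{t-1}=\emptyset$, and otherwise $p_{t-1}=q_j^\star$, where $j$ minimizes $|p^{\mathrm{ce}}_{t-1}-q_i^\star|$ over $i\in\mathcal S_{t-1}$ (ties are broken by any fixed rule depending on $\tau$ and $B_{t-1}$). For $t=\tilde T+1,\dots,T$ the threshold is constant, $p_{t-1}=1-B_{\tilde T}/(T-\tilde T)$. At each $t=1,\dots,T$, observe $\theta_t$ and draw $X_t$ uniformly, with fresh independent randomness, from the interval (possibly a single point) $\{q\in[0,1]:F^{-1}(q)=\theta_t\}$; if $X_t\ge p_{t-1}$ and $B_{t-1}>0$, hire and set $B_t=B_{t-1}-1$; otherwise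 reject and set $B_t=B_{t-1}$. **Theorem.** There is a universal constant $C<\infty$ such that for every $\beta\in[0,\infty)$ and $\varepsilon_0\in(0,1]$, every $(\beta,\varepsilon_0)$-clustered distribution $F$ on $[0,1]$ with any such gap quantiles, every $T\in\mathbb N$ and every $B\in\{1,\dots,T\}$, the CwG policy satisfies $$\mathrm{Regret}(B,T;\mathrm{CwG})\le C\Big(1+\frac1\beta\Big)(\log T)^{\frac12+\frac1{2(\beta+1)}}\,T^{\frac12-\frac1{2(\beta+1)}}\,\mathbb 1\{\beta>0\}+C(\log T)^2+C\,\frac{\sqrt{\log(1/\varepsilon_0)}}{\varepsilon_0},$$ where the first term is $0$ when $\beta=0$. -/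

import Mathlib

open MeasureTheory ProbabilityTheory

namespace MultiSecretary

/-! ### Distributions on `[0,1]`, quantile function, clustered distributions -/

/-- The quantile function `F⁻¹(q) = inf {v : F(v) ≥ q}` of a law `P` on `[0,1]` with distribution
function `F = cdf P`; abilities `v` range over `[0,1]`. -/
noncomputable def quantile (P : Measure ℝ) (q : ℝ) : ℝ :=
  sInf {v : ℝ | v ∈ Set.Icc (0 : ℝ) 1 ∧ q ≤ cdf P v}

/-- `g 0 = 0 < g 1 < ⋯ < g n < g (n+1) = 1` are gap quantiles witnessing that the law `P` is
`(β, ε₀)`-clustered. -/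
structure IsGapQuantiles (P : Measure ℝ) (β ε₀ : ℝ) {n : ℕ} (g : Fin (n + 2) → ℝ) : Prop where
  zero : g 0 = 0
  last : g (Fin.last (n + 1)) = 1
  strictMono : StrictMono g
  /-- cluster density requirement -/
  density : ∀ i : Fin (n + 1), ∀ q ∈ Set.Ioc (g i.castSucc) (g i.succ),
    ∀ q' ∈ Set.Ioc (g i.castSucc) (g i.succ),
      |quantile P q - quantile P q'| ≤ |q - q'| ^ (1 / (β + 1))
  /-- cluster size requirement -/
  size : ∀ i : Fin (n + 1), ε₀ ≤ g i.succ - g i.castSucc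

/-- The `i`-th interior gap quantile (`0 < · < 1`), for `i = 0, …, n - 1`. -/
def innerGap {n : ℕ} (g : Fin (n + 2) → ℝ) (i : Fin n) : ℝ := g i.castSucc.succ

/-! ### The multi-secretary problem: policies and regret -/

/-- A sample path: the ability `(ω t).1` of each candidate and a randomization seed `(ω t).2`. -/
abbrev Path (T : ℕ) : Type := Fin T → ℝ × ℝ

/-- Abilities are i.i.d. with law `P`; the seeds are i.i.d. uniform on `[0,1]` and independent of
the abilities. -/
noncomputable def pathLaw (P : Measure ℝ) (T : ℕ) : Measure (Path T) :=
  Measure.pi fun _ : Fin T => P.prod (volume.restrict (Set.Icc (0 : ℝ) 1))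

/-- The offline value on a path of abilities: the largest total ability of at most `B`
candidates. -/
noncomputable def offline {T : ℕ} (B : ℕ) (θ : Fin T → ℝ) : ℝ :=
  (Finset.univ.filter fun s : Finset (Fin T) => s.card ≤ B).sup' ⟨∅, by simp⟩
    fun s => ∑ t ∈ s, θ t

/-- Expected regret, against the offline optimum with budget `B`, of the policy that hires the set
`π ω` of candidates on the path `ω`. -/
noncomputable def regret (P : Measure ℝ) (T B : ℕ) (π : Path T → Finset (Fin T)) : ℝ :=
  (∫ ω, offline B (fun t => (ω t).1) ∂pathLaw P T)
    - ∫ ω, ∑ t ∈ π ω, (ω t).1 ∂pathLaw P T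

/-! ### The CwG policy -/

/-- The set `{q ∈ [0,1] : F⁻¹(q) = θ}`, an interval, possibly a single point (it is empty only for
a null set of abilities `θ`). -/
def quantileSet (P : Measure ℝ) (θ : ℝ) : Set ℝ :=
  {q : ℝ | q ∈ Set.Icc (0 : ℝ) 1 ∧ quantile P q = θ}

/-- The uniform sample from the interval `quantileSet P θ` obtained from a seed `u` that is uniform
on `[0,1]`. -/
noncomputable def quantileSample (P : Measure ℝ) (θ u : ℝ) : ℝ :=
  sInf (quantileSet P θ) + u * (sSup (quantileSet P θ) - sInf (quantileSet P θ))

/-- Certainty equivalent quantile threshold, with `τ` candidates and budget `b` remaining. -/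
noncomputable def ceThreshold (τ b : ℕ) : ℝ := 1 - (b : ℝ) / (τ : ℝ)

/-- The gap quantiles that are close to the certainty equivalent threshold. -/
def nearGaps {n : ℕ} (g : Fin (n + 2) → ℝ) (τ b : ℕ) : Set (Fin n) :=
  {i | ceThreshold τ b ∈ Metric.ball (innerGap g i) (Real.sqrt (2 * (Real.log τ / τ)))}

/-- `p τ b` is the conservative threshold for `τ` remaining candidates and remaining budget `b`:
the certainty equivalent threshold if no gap quantile is close to it, and otherwise a closest gap
quantile, ties being broken in any way. -/
def IsCwGThreshold {n : ℕ} (g : Fin (n + 2) → ℝ) (p : ℕ → ℕ → ℝ) : Prop :=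
  ∀ τ b : ℕ,
    (nearGaps g τ b = ∅ → p τ b = ceThreshold τ b) ∧
    ((nearGaps g τ b).Nonempty → ∃ j ∈ nearGaps g τ b,
      (∀ i ∈ nearGaps g τ b,
        |ceThreshold τ b - innerGap g j| ≤ |ceThreshold τ b - innerGap g i|) ∧
      p τ b = innerGap g j)

/-- Remaining budget after `t` candidates when the candidate arriving after `t` others is hired iff
its sampled quantile is at least `thr t b` and the remaining budget `b` is positive. -/
noncomputable def budget {T : ℕ} (thr : ℕ → ℕ → ℝ) (x : Fin T → ℝ) (B : ℕ) : ℕ → ℕ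
  | 0 => B
  | t + 1 =>
    if h : t < T then
      if thr t (budget thr x B t) ≤ x ⟨t, h⟩ ∧ 0 < budget thr x B t
      then budget thr x B t - 1 else budget thr x B t
    else budget thr x B t

/-- Length of the first phase, `max {0, T - ⌊16 log(1/ε₀) / ε₀²⌋}`. -/
noncomputable def phaseOne (T : ℕ) (ε₀ : ℝ) : ℕ :=
  T - ⌊16 * Real.log (1 / ε₀) / ε₀ ^ 2⌋₊

/-- The threshold of the CwG policy after `t` candidates with remaining budget `b`: the conservative
threshold during the first phase; afterwards the certainty equivalent threshold computed once, at
the end of the first phase, from the budget remaining then. -/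
noncomputable def cwgThreshold {T : ℕ} (ε₀ : ℝ) (p : ℕ → ℕ → ℝ) (x : Fin T → ℝ) (B : ℕ)
    (t b : ℕ) : ℝ :=
  if t < phaseOne T ε₀ then p (T - t) b
  else ceThreshold (T - phaseOne T ε₀)
    (budget (fun s c => p (T - s) c) x B (phaseOne T ε₀))

/-- The CwG policy: the set of candidates it hires on the path `ω`. -/
noncomputable def cwg (P : Measure ℝ) (ε₀ : ℝ) (p : ℕ → ℕ → ℝ) (T B : ℕ) (ω : Path T) :
    Finset (Fin T) :=
  let x : Fin T → ℝ := fun t => quantileSample P (ω t).1 (ω t).2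
  let thr : ℕ → ℕ → ℝ := cwgThreshold ε₀ p x B
  Finset.univ.filter fun t : Fin T => thr t (budget thr x B t) ≤ x t ∧ 0 < budget thr x B t

end MultiSecretary

namespace MultiSecretary

/-! ### The offline value -/

/-! Reduction to uniform variables. The sampled quantile of a candidate is almost surely the
distributional transform of the ability, which is uniform on `[0,1]` and from which the quantile
function `f` recovers the ability (`measurePreserving_distTransform`, `ae_quantileSample`). So
abilities may be taken to be `f (x t)` with `x t` i.i.d. uniform (`regret_cwg_le`).

Compensated coupling. On each path, the offline value minus the reward telescopes into step losses:
what an offline optimizer loses by being forced to follow the policy for one candidate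
(`twoPhaseLoss_cons`). If `Δ` is the value, among the later candidates, of the last unit of budget,
hiring `a` costs at most `(Δ - f a)⁺` and rejecting it at most `(f a - Δ)⁺`. Here `Δ` is `f` at an
order statistic of the later uniforms, which by Hoeffding's inequality lies, up to a small
probability, within `r = √(2 log τ / τ)` of the certainty equivalent threshold.

Why conservatism works. On that event the loss vanishes unless `a` falls in the window, and it is
bounded by the variation of `f` on one side of the threshold (`stepLoss_le`); a jump of `f` at the
threshold itself costs nothing. A threshold that is far from all gaps, or exactly on one, has a
single cluster on each side of it within the window. The expected step loss is then of order `r ^ (1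
+ 1/(β+1))`, one factor for the probability of the window and one for the variation, plus a tail
(`hasStepBound_far`, `hasStepBound_near`). Summing over `τ` gives the power of `T`, or `(log T)²`
when `β = 0`.

Dependence on `ε₀`. Near a gap, the window must not reach the next gap, so its radius is also capped
by `ρ * ε₀`; the resulting tails sum to `O(√(log (1/ε₀)) / ε₀)` as long as enough candidates remain
(`exists_margin`). The last candidates face a constant threshold, which costs a binomial deviation,
at most the square root of their number (`lintegral_static_loss_le`). -/

lemma le_offline {T : ℕ} {b : ℕ} {θ : Fin T → ℝ} {s : Finset (Fin T)} (hs : s.card ≤ b) :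
    ∑ t ∈ s, θ t ≤ offline b θ :=
  Finset.le_sup' (fun s : Finset (Fin T) => ∑ t ∈ s, θ t) (by simpa using hs)

lemma offline_le {T : ℕ} {b : ℕ} {θ : Fin T → ℝ} {c : ℝ}
    (h : ∀ s : Finset (Fin T), s.card ≤ b → ∑ t ∈ s, θ t ≤ c) : offline b θ ≤ c :=
  Finset.sup'_le _ _ fun s hs => h s (by simpa using hs)

lemma exists_offline_eq {T : ℕ} (b : ℕ) (θ : Fin T → ℝ) :
    ∃ s : Finset (Fin T), s.card ≤ b ∧ offline b θ = ∑ t ∈ s, θ t := by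
  obtain ⟨s, hs, h⟩ := Finset.exists_mem_eq_sup'
    (s := Finset.univ.filter fun s : Finset (Fin T) => s.card ≤ b) ⟨∅, by simp⟩
    (fun s => ∑ t ∈ s, θ t)
  exact ⟨s, by simpa using hs, h⟩

lemma offline_nonneg {T : ℕ} (b : ℕ) (θ : Fin T → ℝ) : 0 ≤ offline b θ := by
  simpa using le_offline (b := b) (θ := θ) (s := ∅) (by simp)

lemma offline_zero {T : ℕ} (θ : Fin T → ℝ) : offline 0 θ = 0 := by
  obtain ⟨s, hs, h⟩ := exists_offline_eq 0 θ
  have : s = ∅ := by simpa using hs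
  simp [h, this]

lemma offline_mono {T : ℕ} {b b' : ℕ} (h : b ≤ b') (θ : Fin T → ℝ) :
    offline b θ ≤ offline b' θ :=
  offline_le fun _ hs => le_offline (hs.trans h)

lemma offline_le_card {T : ℕ} (b : ℕ) {θ : Fin T → ℝ} (hθ : ∀ i, θ i ≤ 1) :
    offline b θ ≤ T := by
  refine offline_le fun s _ => ?_
  calc ∑ t ∈ s, θ t ≤ ∑ _t ∈ s, (1 : ℝ) := Finset.sum_le_sum fun i _ => hθ i
    _ = s.card := by simp
    _ ≤ T := by exact_mod_cast (Finset.card_le_univ s).trans (by simp)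

/-- Dropping the least valuable hire: if at most `b` values exceed `c`, then the `(b + 1)`-st unit
of budget is worth at most `c`. -/
lemma offline_succ_le {T : ℕ} {b : ℕ} {θ : Fin T → ℝ} {c : ℝ} (hc : 0 ≤ c)
    {H : Finset (Fin T)} (hH : H.card ≤ b) (hθ : ∀ i ∉ H, θ i ≤ c) :
    offline (b + 1) θ ≤ offline b θ + c := by
  refine offline_le fun s hs => ?_
  by_cases hsb : s.card ≤ b
  · linarith [le_offline (θ := θ) hsb]
  · obtain ⟨i, his, hiH⟩ : ∃ i ∈ s, i ∉ H := by
      by_contra! hcon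
      exact hsb ((Finset.card_le_card hcon).trans hH)
    rw [← Finset.sum_erase_add s θ his]
    have h1 : (s.erase i).card ≤ b := by rw [Finset.card_erase_of_mem his]; omega
    linarith [le_offline (θ := θ) h1, hθ i hiH]

/-- Adding one more hire: the `(b + 1)`-st unit of budget is worth at least some value from any
given set of more than `b` candidates. -/
lemma exists_add_le_offline_succ {T : ℕ} {b : ℕ} (θ : Fin T → ℝ) {K : Finset (Fin T)}
    (hK : b < K.card) : ∃ i ∈ K, offline b θ + θ i ≤ offline (b + 1) θ := by
  obtain ⟨s, hs, h⟩ := exists_offline_eq b θ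
  obtain ⟨i, hiK, his⟩ : ∃ i ∈ K, i ∉ s := by
    by_contra! hcon
    exact absurd (Finset.card_le_card hcon) (by omega)
  refine ⟨i, hiK, ?_⟩
  rw [h, add_comm, ← Finset.sum_insert his]
  exact le_offline ((Finset.card_insert_le _ _).trans (by omega))

/-- The Bellman inequality of the offline problem: an optimal set either skips the first candidate
or spends one unit of budget on it. -/
lemma offline_cons_le {T : ℕ} (b : ℕ) (a : ℝ) (θ : Fin T → ℝ) :
    offline (b + 1) (Fin.cons a θ : Fin (T + 1) → ℝ) ≤
      max (offline (b + 1) θ) (a + offline b θ) := by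
  refine offline_le fun s hs => ?_
  set s' : Finset (Fin T) := Finset.univ.filter fun i => i.succ ∈ s
  have hsum : ∑ t ∈ s, (Fin.cons a θ : Fin (T + 1) → ℝ) t
      = (if 0 ∈ s then a else 0) + ∑ t ∈ s', θ t := by
    rw [← Finset.sum_ite_mem_eq s, Fin.sum_univ_succ, Finset.sum_filter]
    simp
  have hcard : s.card = (if 0 ∈ s then 1 else 0) + s'.card := by
    rw [Finset.card_eq_sum_ones, ← Finset.sum_ite_mem_eq s, Fin.sum_univ_succ,
      Finset.card_filter]
  rw [hsum]
  by_cases h0 : 0 ∈ s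
  · simp only [h0, if_true] at hcard ⊢
    exact le_max_of_le_right (by linarith [le_offline (b := b) (θ := θ) (s := s') (by omega)])
  · simp only [h0, if_false] at hcard ⊢
    exact le_max_of_le_left
      (by linarith [le_offline (b := b + 1) (θ := θ) (s := s') (by omega)])

lemma offline_eq_sum {T : ℕ} {b : ℕ} (hb : T ≤ b) {θ : Fin T → ℝ} (hθ : ∀ i, 0 ≤ θ i) :
    offline b θ = ∑ i, θ i := by
  apply le_antisymm
  · exact offline_le fun s _ => Finset.sum_le_univ_sum_of_nonneg hθ
  · exact le_offline (by simpa using hb)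

/-- The loss of a policy that hires `S`, a subset of the candidates `A` of value at least `c`. -/
lemma offline_le_sum_add {T : ℕ} {b : ℕ} {θ : Fin T → ℝ} {c : ℝ} (hc0 : 0 ≤ c) (hc1 : c ≤ 1)
    {A S : Finset (Fin T)} (hSA : S ⊆ A) (hS : S.card ≤ b) (hθ1 : ∀ i, θ i ≤ 1)
    (hA : ∀ i ∈ A, c ≤ θ i) (hA' : ∀ i ∉ A, θ i ≤ c) :
    offline b θ ≤ ∑ i ∈ S, θ i + ((A \ S).card + ((b : ℝ) - S.card)) := by
  refine offline_le fun s hs => ?_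
  have e1 : ∑ i ∈ s, θ i = ∑ i ∈ s \ S, θ i + ∑ i ∈ s ∩ S, θ i := by
    rw [add_comm, Finset.sum_inter_add_sum_sdiff]
  have e2 : ∑ i ∈ S, θ i = ∑ i ∈ S \ s, θ i + ∑ i ∈ s ∩ S, θ i := by
    rw [add_comm, Finset.inter_comm, Finset.sum_inter_add_sum_sdiff]
  have c1 : (s.card : ℝ) = (s \ S).card + (s ∩ S).card := by
    exact_mod_cast (by rw [add_comm]; exact (Finset.card_inter_add_card_sdiff s S).symm)
  have c2 : (S.card : ℝ) = (S \ s).card + (s ∩ S).card := by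
    exact_mod_cast (by
      rw [add_comm, Finset.inter_comm]; exact (Finset.card_inter_add_card_sdiff S s).symm)
  have h1 : ∑ i ∈ s \ S, θ i ≤ (A \ S).card + (s \ S).card * c := by
    calc ∑ i ∈ s \ S, θ i ≤ ∑ i ∈ s \ S, ((if i ∈ A \ S then 1 else 0) + c) := by
          refine Finset.sum_le_sum fun i hi => ?_
          have hi' := (Finset.mem_sdiff.1 hi).2
          by_cases hiA : i ∈ A
          · simp only [Finset.mem_sdiff, hiA, hi', not_false_eq_true, and_self, if_true]
            linarith [hθ1 i]
          · simp only [Finset.mem_sdiff, hiA, false_and, if_false]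
            linarith [hA' i hiA]
      _ = ((s \ S).filter (· ∈ A \ S)).card + (s \ S).card * c := by
          rw [Finset.sum_add_distrib]; simp
      _ ≤ _ := by
          have : ((s \ S).filter (· ∈ A \ S)).card ≤ (A \ S).card :=
            Finset.card_le_card fun i hi => (Finset.mem_filter.1 hi).2
          have : (((s \ S).filter (· ∈ A \ S)).card : ℝ) ≤ (A \ S).card := by exact_mod_cast this
          linarith
  have h2 : (S \ s).card * c ≤ ∑ i ∈ S \ s, θ i := by
    rw [← nsmul_eq_mul]
    exact Finset.card_nsmul_le_sum _ _ _ fun i hi => hA i (hSA (Finset.mem_sdiff.1 hi).1)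
  have hs' : (s.card : ℝ) ≤ b := by exact_mod_cast hs
  have hS' : (S.card : ℝ) ≤ b := by exact_mod_cast hS
  have h3 : ((s \ S).card : ℝ) * c ≤ (S \ s).card * c + (b - S.card) := by
    have : ((s \ S).card : ℝ) ≤ (S \ s).card + (b - S.card) := by linarith
    nlinarith
  linarith

/-! ### Threshold policies -/

/-- The candidates hired by the policy with thresholds `thr`. -/
noncomputable def hired {T : ℕ} (thr : ℕ → ℕ → ℝ) (x : Fin T → ℝ) (b : ℕ) : Finset (Fin T) :=
  Finset.univ.filter fun t : Fin T => thr t (budget thr x b t) ≤ x t ∧ 0 < budget thr x b t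

/-- First-step analysis: `budget` recurses on the last candidate, whereas the telescoping of the
loss peels off the first. -/
lemma budget_cons {T : ℕ} (thr : ℕ → ℕ → ℝ) (a : ℝ) (y : Fin T → ℝ) (b t : ℕ) :
    budget thr (Fin.cons a y : Fin (T + 1) → ℝ) b (t + 1) =
      budget (fun s => thr (s + 1)) y (if thr 0 b ≤ a ∧ 0 < b then b - 1 else b) t := by
  induction t with
  | zero => simp [budget]
  | succ t ih =>
    rw [budget, ih]
    by_cases ht : t < T
    · have h1 : (Fin.cons a y : Fin (T + 1) → ℝ) ⟨t + 1, by omega⟩ = y ⟨t, ht⟩ :=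
        Fin.cons_succ (α := fun _ => ℝ) a y ⟨t, ht⟩
      rw [dif_pos (by omega : t + 1 < T + 1), h1]
      conv_rhs => rw [budget, dif_pos ht]
    · rw [dif_neg (by omega : ¬ t + 1 < T + 1)]
      conv_rhs => rw [budget, dif_neg ht]

lemma budget_antitone {T : ℕ} (thr : ℕ → ℕ → ℝ) (x : Fin T → ℝ) (b : ℕ) :
    Antitone (budget thr x b) := by
  refine antitone_nat_of_succ_le fun t => ?_
  rw [budget]
  split_ifs <;> omega

lemma card_hired_add_budget {T : ℕ} (thr : ℕ → ℕ → ℝ) (x : Fin T → ℝ) (b : ℕ) :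
    (hired thr x b).card + budget thr x b T = b := by
  have key : ∀ t ≤ T, ((hired thr x b).filter fun i : Fin T => (i : ℕ) < t).card
      + budget thr x b t = b := by
    intro t
    induction t with
    | zero => simp [budget]
    | succ t ih =>
      intro ht
      have ht' : t < T := by omega
      have ih := ih (by omega)
      have hsplit : ((hired thr x b).filter fun i : Fin T => (i : ℕ) < t + 1) =
          if thr t (budget thr x b t) ≤ x ⟨t, ht'⟩ ∧ 0 < budget thr x b t then
            insert ⟨t, ht'⟩ ((hired thr x b).filter fun i : Fin T => (i : ℕ) < t)
          else ((hired thr x b).filter fun i : Fin T => (i : ℕ) < t) := by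
        ext i
        by_cases hit : i = ⟨t, ht'⟩
        · subst hit
          split_ifs with hh <;> simp [hired, hh]
        · have : (i : ℕ) ≠ t := fun h => hit (Fin.ext h)
          split_ifs <;> simp [hit] <;> intro _ <;> omega
      rw [hsplit, budget, dif_pos ht']
      split_ifs with hh
      · rw [Finset.card_insert_of_notMem (by simp)]
        omega
      · exact ih
  have := key T le_rfl
  rwa [Finset.filter_true_of_mem fun i _ => i.2] at this

/-- A constant threshold errs in one direction only. If the budget runs out, the loss comes from the
qualified candidates left over; otherwise every qualified candidate is hired, and the loss comes
from the unused budget. -/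
lemma static_loss_le {T b : ℕ} {f : ℝ → ℝ} (hf : Monotone f) (hf0 : ∀ x, 0 ≤ f x)
    (hf1 : ∀ x, f x ≤ 1) (c : ℝ) (x : Fin T → ℝ) :
    offline b (fun i => f (x i)) - ∑ i ∈ hired (fun _ _ => c) x b, f (x i) ≤
      |((Finset.univ.filter fun i => c ≤ x i).card : ℝ) - b| := by
  set A : Finset (Fin T) := Finset.univ.filter fun i => c ≤ x i
  set S := hired (fun _ _ => c) x b
  have hcard := card_hired_add_budget (fun _ _ => c) x b
  have hSA : S ⊆ A := fun i hi => by
    simp only [S, hired, Finset.mem_filter, Finset.mem_univ, true_and] at hi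
    simpa [A] using hi.1
  have hS : S.card ≤ b := by simp only [S]; omega
  have h := offline_le_sum_add (b := b) (θ := fun i => f (x i)) (hf0 c) (hf1 c) hSA hS
    (fun i => hf1 _) (fun i hi => hf (by simpa [A] using hi))
    (fun i hi => hf (by simpa [A] using (le_of_lt (by simpa [A] using hi : x i < c))))
  have hd : (((A \ S).card : ℕ) : ℝ) = A.card - S.card := by
    rw [Finset.card_sdiff_of_subset hSA, Nat.cast_sub (Finset.card_le_card hSA)]
  rcases Nat.eq_zero_or_pos (budget (fun _ _ => c) x b T) with h0 | h0
  · have : (S.card : ℝ) = b := by exact_mod_cast (by simp only [S]; omega : S.card = b)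
    have := le_abs_self ((A.card : ℝ) - b)
    linarith
  · have : S = A := by
      refine hSA.antisymm fun i hi => ?_
      simp only [S, hired, Finset.mem_filter, Finset.mem_univ, true_and]
      exact ⟨by simpa [A] using hi, h0.trans_le (budget_antitone _ x b i.2.le)⟩
    rw [this] at h hd ⊢
    have := neg_abs_le ((A.card : ℝ) - b)
    linarith

lemma static_loss_nonpos {T b : ℕ} (hb : T ≤ b) {f : ℝ → ℝ} (hf0 : ∀ x, 0 ≤ f x)
    {c : ℝ} (x : Fin T → ℝ) (hx : ∀ i, c ≤ x i) :
    offline b (fun i => f (x i)) - ∑ i ∈ hired (fun _ _ => c) x b, f (x i) ≤ 0 := by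
  have hcard := card_hired_add_budget (fun _ _ => c) x b
  have : hired (fun _ _ => c) x b = Finset.univ := by
    rcases Nat.eq_zero_or_pos (budget (fun _ _ => c) x b T) with h0 | h0
    · apply Finset.eq_univ_of_card
      have := Finset.card_le_univ (hired (fun _ _ => c) x b)
      simp only [Fintype.card_fin] at this ⊢
      omega
    · refine Finset.eq_univ_of_forall fun i => ?_
      simp only [hired, Finset.mem_filter, Finset.mem_univ, true_and]
      exact ⟨hx i, h0.trans_le (budget_antitone _ x b i.2.le)⟩
  rw [this, offline_eq_sum hb fun i => hf0 _, sub_self]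

/-- The policy with thresholds `p τ b` for its first `k` candidates, and a constant threshold,
certainty equivalent at that time, afterwards. -/
noncomputable def twoPhase {T : ℕ} (k : ℕ) (p : ℕ → ℕ → ℝ) (x : Fin T → ℝ) (B t b : ℕ) : ℝ :=
  if t < k then p (T - t) b
  else ceThreshold (T - k) (budget (fun s c => p (T - s) c) x B k)

/-- The loss of the two-phase policy on a path. -/
noncomputable def twoPhaseLoss {T : ℕ} (f : ℝ → ℝ) (k : ℕ) (p : ℕ → ℕ → ℝ) (b : ℕ)
    (x : Fin T → ℝ) : ℝ :=
  offline b (fun i => f (x i)) - ∑ i ∈ hired (twoPhase k p x b) x b, f (x i)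

lemma cwg_eq_hired (P : Measure ℝ) (ε₀ : ℝ) (p : ℕ → ℕ → ℝ) (T B : ℕ) (ω : Path T) :
    cwg P ε₀ p T B ω = hired
      (twoPhase (phaseOne T ε₀) p (fun t => quantileSample P (ω t).1 (ω t).2) B)
      (fun t => quantileSample P (ω t).1 (ω t).2) B := rfl

lemma twoPhase_zero {T : ℕ} (p : ℕ → ℕ → ℝ) (x : Fin T → ℝ) (b : ℕ) :
    twoPhase 0 p x b = fun _ _ => ceThreshold T b := by
  funext t c
  simp [twoPhase, budget]

/-- The policy restarts as a policy of the same kind after each first-phase candidate, because `p`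
depends on time only through the number of remaining candidates and the second phase keeps its
length. -/
lemma twoPhase_cons {T : ℕ} (k : ℕ) (p : ℕ → ℕ → ℝ) (a : ℝ) (y : Fin T → ℝ) (b t : ℕ) :
    twoPhase (k + 1) p (Fin.cons a y : Fin (T + 1) → ℝ) b (t + 1) =
      twoPhase k p y (if p (T + 1) b ≤ a ∧ 0 < b then b - 1 else b) t := by
  funext c
  simp only [twoPhase, budget_cons, Nat.add_lt_add_iff_right, Nat.add_sub_add_right]
  rfl

lemma sum_hired {T : ℕ} (thr : ℕ → ℕ → ℝ) (x : Fin T → ℝ) (b : ℕ) (f : ℝ → ℝ) :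
    ∑ i ∈ hired thr x b, f (x i) =
      ∑ i : Fin T, if thr i (budget thr x b i) ≤ x i ∧ 0 < budget thr x b i then f (x i) else 0 :=
  Finset.sum_filter _ _

lemma sum_hired_cons {T : ℕ} (k : ℕ) (p : ℕ → ℕ → ℝ) (a : ℝ) (y : Fin T → ℝ) (b : ℕ)
    (f : ℝ → ℝ) :
    ∑ i ∈ hired (twoPhase (k + 1) p (Fin.cons a y : Fin (T + 1) → ℝ) b) (Fin.cons a y) b,
        f ((Fin.cons a y : Fin (T + 1) → ℝ) i) =
      (if p (T + 1) b ≤ a ∧ 0 < b then f a else 0) +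
        ∑ i ∈ hired (twoPhase k p y (if p (T + 1) b ≤ a ∧ 0 < b then b - 1 else b)) y
          (if p (T + 1) b ≤ a ∧ 0 < b then b - 1 else b), f (y i) := by
  have h0 : ∀ c, twoPhase (k + 1) p (Fin.cons a y : Fin (T + 1) → ℝ) b 0 c = p (T + 1) c := by
    intro c
    simp [twoPhase]
  rw [sum_hired, sum_hired, Fin.sum_univ_succ]
  refine congrArg₂ (· + ·) ?_ (Finset.sum_congr rfl fun i _ => ?_)
  · simp [budget, h0]
  · simp only [Fin.val_succ, budget_cons, twoPhase_cons, h0, Fin.cons_succ]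

/-- The loss incurred by the decision on the first candidate. -/
noncomputable def stepLoss {T : ℕ} (f : ℝ → ℝ) (c : ℝ) (b : ℕ) (a : ℝ) (y : Fin T → ℝ) : ℝ :=
  offline b (fun i => f ((Fin.cons a y : Fin (T + 1) → ℝ) i)) -
    ((if c ≤ a ∧ 0 < b then f a else 0) +
      offline (if c ≤ a ∧ 0 < b then b - 1 else b) (fun i => f (y i)))

lemma twoPhaseLoss_cons {T : ℕ} (f : ℝ → ℝ) (k : ℕ) (p : ℕ → ℕ → ℝ) (b : ℕ) (a : ℝ)
    (y : Fin T → ℝ) :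
    twoPhaseLoss f (k + 1) p b (Fin.cons a y : Fin (T + 1) → ℝ) =
      stepLoss f (p (T + 1) b) b a y +
        twoPhaseLoss f k p (if p (T + 1) b ≤ a ∧ 0 < b then b - 1 else b) y := by
  rw [twoPhaseLoss, sum_hired_cons, twoPhaseLoss, stepLoss]
  ring

lemma comp_cons {T : ℕ} (f : ℝ → ℝ) (a : ℝ) (y : Fin T → ℝ) :
    (fun i => f ((Fin.cons a y : Fin (T + 1) → ℝ) i)) = Fin.cons (f a) (fun i => f (y i)) := by
  funext i
  refine Fin.cases ?_ (fun i => ?_) i <;> simp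

lemma stepLoss_zero {T : ℕ} (f : ℝ → ℝ) (c a : ℝ) (y : Fin T → ℝ) :
    stepLoss f c 0 a y = 0 := by
  simp [stepLoss, offline_zero]

lemma stepLoss_of_hire {T : ℕ} {f : ℝ → ℝ} {c a : ℝ} (b : ℕ) (y : Fin T → ℝ) (h : c ≤ a) :
    stepLoss f c (b + 1) a y ≤
      max 0 (offline (b + 1) (fun i => f (y i)) - offline b (fun i => f (y i)) - f a) := by
  rw [stepLoss, if_pos ⟨h, by omega⟩, if_pos ⟨h, by omega⟩, comp_cons]
  have := offline_cons_le b (f a) (fun i => f (y i))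
  rcases le_max_iff.1 this with h | h
  · exact le_max_of_le_right (by simp only [Nat.add_sub_cancel]; linarith)
  · exact le_max_of_le_left (by simp only [Nat.add_sub_cancel]; linarith)

lemma stepLoss_of_reject {T : ℕ} {f : ℝ → ℝ} {c a : ℝ} (b : ℕ) (y : Fin T → ℝ) (h : a < c) :
    stepLoss f c (b + 1) a y ≤
      max 0 (f a - (offline (b + 1) (fun i => f (y i)) - offline b (fun i => f (y i)))) := by
  have hn : ¬ (c ≤ a ∧ 0 < b + 1) := fun hh => not_le.2 h hh.1
  rw [stepLoss, if_neg hn, if_neg hn, comp_cons]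
  have := offline_cons_le b (f a) (fun i => f (y i))
  rcases le_max_iff.1 this with h | h
  · exact le_max_of_le_left (by linarith)
  · exact le_max_of_le_right (by linarith)

lemma stepLoss_le_one {T : ℕ} {f : ℝ → ℝ} (hf0 : ∀ x, 0 ≤ f x) (hf1 : ∀ x, f x ≤ 1)
    (c : ℝ) (b : ℕ) (a : ℝ) (y : Fin T → ℝ) : stepLoss f c b a y ≤ 1 := by
  rcases b with _ | b
  · rw [stepLoss_zero]; exact zero_le_one
  · have h1 := offline_succ_le (b := b) (θ := fun i => f (y i)) zero_le_one (H := ∅) (by simp)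
      (fun i _ => hf1 _)
    have h2 := offline_mono (Nat.le_succ b) (fun i => f (y i))
    rcases le_or_gt c a with h | h
    · exact (stepLoss_of_hire b y h).trans (max_le zero_le_one (by linarith [hf0 a]))
    · exact (stepLoss_of_reject b y h).trans (max_le zero_le_one (by linarith [hf1 a]))

/-- With a budget for everyone, hiring is optimal. -/
lemma stepLoss_nonpos {T : ℕ} {f : ℝ → ℝ} (hf0 : ∀ x, 0 ≤ f x) {c : ℝ} {b : ℕ} (hb : T < b)
    {a : ℝ} (hc : c ≤ a) (y : Fin T → ℝ) : stepLoss f c b a y ≤ 0 := by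
  obtain ⟨b, rfl⟩ : ∃ b', b = b' + 1 := ⟨b - 1, by omega⟩
  refine (stepLoss_of_hire b y hc).trans (max_le le_rfl ?_)
  rw [offline_eq_sum (by omega) fun i => hf0 _, offline_eq_sum (by omega) fun i => hf0 _]
  linarith [hf0 a]

/-- If the marginal value of the budget is attained in a window `(l, h]` around the threshold on
both sides of which `f` varies by at most `K`, then the loss is at most `K`, and vanishes for
candidates outside the window. -/
lemma stepLoss_le {T : ℕ} {f : ℝ → ℝ} (hf : Monotone f) (hf0 : ∀ x, 0 ≤ f x) {l c h K : ℝ}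
    (hlc : l ≤ c) (hch : c ≤ h) (hK : 0 ≤ K)
    (h1 : ∀ x ∈ Set.Ioc l c, ∀ x' ∈ Set.Ioc l c, f x - f x' ≤ K)
    (h2 : ∀ x ∈ Set.Ioc c h, ∀ x' ∈ Set.Ioc c h, f x - f x' ≤ K)
    {b : ℕ} {a : ℝ} (ha : a ≠ c) (y : Fin T → ℝ)
    (hy1 : (Finset.univ.filter fun i => h < y i).card < b)
    (hy2 : b ≤ (Finset.univ.filter fun i => l < y i).card) :
    stepLoss f c b a y ≤ (Set.Ioc l h).indicator (fun _ => K) a := by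
  obtain ⟨b, rfl⟩ : ∃ b', b = b' + 1 := ⟨b - 1, by omega⟩
  have hind : 0 ≤ (Set.Ioc l h).indicator (fun _ => K) a :=
    Set.indicator_nonneg (fun _ _ => hK) a
  have hΔ := offline_succ_le (b := b) (θ := fun i => f (y i)) (hf0 h)
    (H := Finset.univ.filter fun i => h < y i) (by omega) (fun i hi => hf (by simpa using hi))
  obtain ⟨i, hi, hΔ'⟩ := exists_add_le_offline_succ (b := b) (fun i => f (y i))
    (K := Finset.univ.filter fun i => l < y i) (by omega)
  have hi : l < y i := by simpa using hi
  rcases le_or_gt c a with hca | hca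
  -- Strictness matters: clusters are open on the left, so at `a = c` the value `f a` would belong
  -- to the cluster below the threshold although `a` is hired.
  · have hca' : c < a := lt_of_le_of_ne hca (Ne.symm ha)
    refine (stepLoss_of_hire b y hca).trans (max_le hind ?_)
    by_cases hah : a ≤ h
    · rw [Set.indicator_of_mem (Set.mem_Ioc.2 ⟨hlc.trans_lt hca', hah⟩)]
      linarith [h2 h ⟨hca'.trans_le hah, le_rfl⟩ a ⟨hca', hah⟩]
    · linarith [hf (not_le.1 hah).le]
  · refine (stepLoss_of_reject b y hca).trans (max_le hind ?_)
    by_cases hla : l < a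
    · rw [Set.indicator_of_mem (Set.mem_Ioc.2 ⟨hla, hca.le.trans hch⟩)]
      rcases le_or_gt a (y i) with hay | hay
      · linarith [hf hay]
      · linarith [h1 a ⟨hla, hca.le⟩ (y i) ⟨hi, hay.le.trans hca.le⟩]
    · linarith [hf ((not_lt.1 hla).trans hi.le)]

/-! ### Concentration of counts -/

section Concentration

variable {ν : Measure ℝ} [IsProbabilityMeasure ν]

lemma integral_pi_indicator {n : ℕ} {A : Set ℝ} (hA : MeasurableSet A) (i : Fin n) :
    ∫ y : Fin n → ℝ, A.indicator (1 : ℝ → ℝ) (y i) ∂(Measure.pi fun _ => ν) = ν.real A := by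
  have hmp := measurePreserving_eval (fun _ : Fin n => ν) i
  rw [← integral_indicator_one hA]
  conv_rhs => rw [← hmp.map_eq]
  rw [integral_map hmp.measurable.aemeasurable
    ((measurable_one.indicator hA).aestronglyMeasurable)]

/-- Hoeffding's inequality: a centred indicator is sub-Gaussian with parameter `1/4`. -/
lemma measure_count_ge_le {n : ℕ} {A : Set ℝ} (hA : MeasurableSet A) {q s : ℝ}
    (hq : ν.real A ≤ q) (hs : 0 ≤ s) :
    (Measure.pi fun _ : Fin n => ν)
        {y | n * q + n * s ≤ ∑ i, A.indicator (1 : ℝ → ℝ) (y i)} ≤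
      ENNReal.ofReal (Real.exp (-2 * n * s ^ 2)) := by
  have hm : Measurable (A.indicator (1 : ℝ → ℝ)) := measurable_one.indicator hA
  have hsub : ∀ i ∈ (Finset.univ : Finset (Fin n)),
      HasSubgaussianMGF (fun y : Fin n → ℝ => A.indicator (1 : ℝ → ℝ) (y i) - ν.real A)
        ((‖(1 : ℝ) - 0‖₊ / 2) ^ 2) (Measure.pi fun _ : Fin n => ν) := by
    intro i _
    rw [← integral_pi_indicator (ν := ν) hA i]
    refine hasSubgaussianMGF_of_mem_Icc (hm.comp (measurable_pi_apply i)).aemeasurable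
      (Filter.Eventually.of_forall fun y => ?_)
    by_cases h : y i ∈ A <;> simp [h]
  have hind := iIndepFun_pi (μ := fun _ : Fin n => ν)
    (X := fun _ a => A.indicator (1 : ℝ → ℝ) a - ν.real A)
    (fun _ => (hm.sub_const _).aemeasurable)
  have h := HasSubgaussianMGF.measure_sum_ge_le_of_iIndepFun hind hsub (ε := n * s) (by positivity)
  rw [← ofReal_measureReal]
  refine ENNReal.ofReal_le_ofReal (le_trans (measureReal_mono ?_) (h.trans (le_of_eq ?_)))
  · intro y hy
    simp only [Set.mem_ofPred_eq, Finset.sum_sub_distrib, Finset.sum_const, Finset.card_univ,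
      Fintype.card_fin, nsmul_eq_mul] at hy ⊢
    have : (n : ℝ) * ν.real A ≤ n * q := by gcongr
    linarith
  · congr 1
    rcases Nat.eq_zero_or_pos n with rfl | hn
    · simp
    · have : (n : ℝ) ≠ 0 := by positivity
      simp
      field_simp

lemma lintegral_abs_count_sub_le {n : ℕ} (hn : 0 < n) {A : Set ℝ} (hA : MeasurableSet A) {c : ℝ}
    (hc : n * ν.real A = c) :
    ∫⁻ y, ENNReal.ofReal |∑ i, A.indicator (1 : ℝ → ℝ) (y i) - c| ∂(Measure.pi fun _ : Fin n => ν)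
      ≤ ENNReal.ofReal (Real.sqrt n) := by
  have hm : Measurable (A.indicator (1 : ℝ → ℝ)) := measurable_one.indicator hA
  set μ := Measure.pi fun _ : Fin n => ν
  set N : (Fin n → ℝ) → ℝ := fun y => ∑ i, A.indicator (1 : ℝ → ℝ) (y i)
  have hN : Measurable N :=
    Finset.measurable_sum _ fun i _ => hm.comp (measurable_pi_apply i)
  have hbd : ∀ a, A.indicator (1 : ℝ → ℝ) a ∈ Set.Icc (0 : ℝ) 1 := fun a => by
    by_cases h : a ∈ A <;> simp [h]
  have hL : MemLp (A.indicator (1 : ℝ → ℝ)) 2 ν :=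
    memLp_of_bounded (Filter.Eventually.of_forall hbd) hm.aestronglyMeasurable 2
  have hNb : ∀ y, N y ∈ Set.Icc (0 : ℝ) n := fun y => by
    refine ⟨Finset.sum_nonneg fun i _ => (hbd _).1, ?_⟩
    calc N y ≤ ∑ _i : Fin n, (1 : ℝ) := Finset.sum_le_sum fun i _ => (hbd _).2
      _ = n := by simp
  have hmean : ∫ y, N y ∂μ = c := by
    rw [integral_finsetSum _ fun i _ => ?_]
    · simp only [μ, integral_pi_indicator hA]
      simpa using hc
    · exact Integrable.of_mem_Icc 0 1 (hm.comp (measurable_pi_apply i)).aemeasurable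
        (Filter.Eventually.of_forall fun y => hbd _)
  have hvar : ∫ y, (N y - c) ^ 2 ∂μ ≤ n / 4 := by
    have h := variance_sum_pi (μ := fun _ : Fin n => ν) (fun _ => hL)
    have h1 : (∑ i : Fin n, fun y : Fin n → ℝ => A.indicator (1 : ℝ → ℝ) (y i)) = N := by
      funext y; simp [N]
    rw [h1, variance_eq_integral hN.aemeasurable, hmean] at h
    rw [h]
    have := variance_le_sq_of_bounded (μ := ν) (Filter.Eventually.of_forall hbd) hm.aemeasurable
    calc ∑ i : Fin n, Var[A.indicator (1 : ℝ → ℝ); ν] ≤ ∑ i : Fin n, (((1 : ℝ) - 0) / 2) ^ 2 :=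
          Finset.sum_le_sum fun _ _ => this
      _ = n / 4 := by simp; ring
  have hr : 0 < Real.sqrt n := Real.sqrt_pos.2 (by exact_mod_cast hn)
  have hr2 : Real.sqrt n ^ 2 = n := Real.sq_sqrt (by positivity)
  have hint2 : Integrable (fun y => (N y - c) ^ 2) μ := by
      refine Integrable.of_bound ((hN.sub_const c).pow_const 2).aestronglyMeasurable
        ((n + |c|) ^ 2) (Filter.Eventually.of_forall fun y => ?_)
      rw [Real.norm_eq_abs, abs_pow]
      gcongr
      have h1 := abs_sub (N y) c
      rw [abs_of_nonneg (hNb y).1] at h1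
      linarith [(hNb y).2]
  -- By AM-GM, `|z| ≤ (z² / √n + √n) / 2`, so the variance bound `n / 4` suffices.
  have hint : Integrable (fun y => ((N y - c) ^ 2 / Real.sqrt n + Real.sqrt n) / 2) μ :=
    ((hint2.div_const _).add (integrable_const _)).div_const 2
  calc ∫⁻ y, ENNReal.ofReal |N y - c| ∂μ
      ≤ ∫⁻ y, ENNReal.ofReal (((N y - c) ^ 2 / Real.sqrt n + Real.sqrt n) / 2) ∂μ := by
        refine lintegral_mono fun y => ENNReal.ofReal_le_ofReal ?_
        rw [le_div_iff₀ two_pos, ← sub_nonneg]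
        have : (N y - c) ^ 2 / Real.sqrt n + Real.sqrt n - |N y - c| * 2
            = (|N y - c| - Real.sqrt n) ^ 2 / Real.sqrt n := by
          rw [← sq_abs (N y - c)]; field_simp; ring
        rw [this]; positivity
    _ = ENNReal.ofReal (∫ y, ((N y - c) ^ 2 / Real.sqrt n + Real.sqrt n) / 2 ∂μ) := by
        rw [ofReal_integral_eq_lintegral_ofReal hint
          (Filter.Eventually.of_forall fun y => by positivity)]
    _ ≤ ENNReal.ofReal (Real.sqrt n) := by
        refine ENNReal.ofReal_le_ofReal ?_
        rw [integral_div, integral_add (hint2.div_const _) (integrable_const _), integral_div]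
        have : (∫ y, (N y - c) ^ 2 ∂μ) / Real.sqrt n ≤ Real.sqrt n := by
          rw [div_le_iff₀ hr]
          nlinarith
        simp
        linarith

end Concentration

/-! ### Conditioning on the first coordinate; the uniform law -/

lemma lintegral_pi_succ {ν : Measure ℝ} [IsProbabilityMeasure ν] (T : ℕ)
    (F : (Fin (T + 1) → ℝ) → ENNReal) :
    ∫⁻ x, F x ∂(Measure.pi fun _ => ν) ≤
      ∫⁻ a, ∫⁻ y : Fin T → ℝ, F (Fin.cons a y) ∂(Measure.pi fun _ => ν) ∂ν := by
  have h := (measurePreserving_piFinSuccAbove (fun _ : Fin (T + 1) => ν) 0).symm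
  rw [← h.lintegral_comp_emb (MeasurableEquiv.measurableEmbedding _)]
  -- This half of Tonelli's theorem holds without measurability of `F`.
  refine (lintegral_prod_le _).trans (le_of_eq ?_)
  simp only [MeasurableEquiv.piFinSuccAbove_symm_apply, Fin.insertNthEquiv, Equiv.coe_fn_mk,
    Fin.insertNth_zero]
  rfl

/-- The uniform law on `[0,1]`. -/
noncomputable abbrev unif : Measure ℝ := volume.restrict (Set.Icc (0 : ℝ) 1)

instance : IsProbabilityMeasure unif := ⟨by simp⟩

lemma ae_unif_mem : ∀ᵐ a ∂unif, a ∈ Set.Icc (0 : ℝ) 1 :=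
  ae_restrict_mem measurableSet_Icc

lemma ae_pi_unif_mem (n : ℕ) :
    ∀ᵐ y ∂(Measure.pi fun _ : Fin n => unif), ∀ i, y i ∈ Set.Icc (0 : ℝ) 1 :=
  ae_all_iff.2 fun i =>
    (measurePreserving_eval (fun _ : Fin n => unif) i).quasiMeasurePreserving.ae ae_unif_mem

lemma unif_Iic {l : ℝ} (h1 : l ≤ 1) : unif (Set.Iic l) = ENNReal.ofReal l := by
  have : Set.Iic l ∩ Set.Icc (0 : ℝ) 1 = Set.Icc 0 l := by
    ext x; simp only [Set.mem_inter_iff, Set.mem_Iic, Set.mem_Icc]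
    constructor
    · rintro ⟨a, b, c⟩; exact ⟨b, a⟩
    · rintro ⟨a, b⟩; exact ⟨b, a, b.trans h1⟩
  rw [Measure.restrict_apply measurableSet_Iic, this, Real.volume_Icc, sub_zero]

lemma unif_real_Iic {l : ℝ} (h0 : 0 ≤ l) (h1 : l ≤ 1) : unif.real (Set.Iic l) = l := by
  rw [measureReal_def, unif_Iic h1, ENNReal.toReal_ofReal h0]

lemma unif_real_Ioi {l : ℝ} (h0 : 0 ≤ l) (h1 : l ≤ 1) : unif.real (Set.Ioi l) = 1 - l := by
  rw [← Set.compl_Iic, probReal_compl_eq_one_sub measurableSet_Iic, unif_real_Iic h0 h1]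

lemma unif_real_Ici {l : ℝ} (h0 : 0 ≤ l) (h1 : l ≤ 1) : unif.real (Set.Ici l) = 1 - l := by
  rw [← unif_real_Ioi h0 h1, measureReal_def, measureReal_def, measure_congr Ioi_ae_eq_Ici]

lemma unif_Ioc_le {l h : ℝ} : unif (Set.Ioc l h) ≤ ENNReal.ofReal (h - l) :=
  (Measure.restrict_apply_le _ _).trans (by simp)

lemma card_filter_eq_sum_indicator {n : ℕ} (A : Set ℝ) [DecidablePred (· ∈ A)] (y : Fin n → ℝ) :
    ((Finset.univ.filter fun i => y i ∈ A).card : ℝ) = ∑ i, A.indicator (1 : ℝ → ℝ) (y i) := by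
  rw [Finset.card_filter]
  push_cast
  refine Finset.sum_congr rfl fun i _ => ?_
  by_cases h : y i ∈ A <;> simp [h]

lemma card_Ioi_eq_sum {n : ℕ} (h : ℝ) (y : Fin n → ℝ) :
    ((Finset.univ.filter fun i => h < y i).card : ℝ)
      = ∑ i, (Set.Ioi h).indicator (1 : ℝ → ℝ) (y i) :=
  card_filter_eq_sum_indicator (Set.Ioi h) y

/-! ### Localization of the marginal candidate, and the expected step loss -/

lemma mul_ceThreshold (n b : ℕ) : (n : ℝ) * ceThreshold (n + 1) b = n - b + b / (n + 1) := by
  rw [ceThreshold]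
  have : (n : ℝ) + 1 ≠ 0 := by positivity
  push_cast
  field_simp
  ring

/-- The threshold is computed for `n + 1` candidates while the count runs over the `n` later ones.
The discrepancy `b / (n + 1)` in `mul_ceThreshold` has the favourable sign here; for the lower tail
below it is at most `1`, which integrality of the count absorbs. A window clipped at the end of
`[0,1]` has no tail at all. -/
lemma measure_le_card_Ioi_le {n b : ℕ} (hb : 1 ≤ b) {h s : ℝ} (h0 : 0 ≤ h) (h1 : h ≤ 1)
    (hs : 0 ≤ s) (hh : ceThreshold (n + 1) b + s ≤ h ∨ h = 1) :
    (Measure.pi fun _ : Fin n => unif) {y | b ≤ (Finset.univ.filter fun i => h < y i).card} ≤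
      ENNReal.ofReal (Real.exp (-2 * n * s ^ 2)) := by
  rcases hh with hh | rfl
  · refine le_trans (measure_mono fun y hy => ?_)
      (measure_count_ge_le (n := n) (measurableSet_Ioi (a := h)) (unif_real_Ioi h0 h1).le hs)
    simp only [Set.mem_ofPred_eq] at hy ⊢
    rw [← card_Ioi_eq_sum]
    have hy' : (b : ℝ) ≤ (Finset.univ.filter fun i => h < y i).card := by exact_mod_cast hy
    have h2 := mul_ceThreshold n b
    have h3 : (n : ℝ) * (ceThreshold (n + 1) b + s) ≤ n * h := by gcongr
    have h4 : (0 : ℝ) ≤ b / (n + 1) := by positivity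
    nlinarith
  · refine le_of_eq_of_le ?_ zero_le
    refine measure_mono_null ?_ (ae_iff.1 (ae_pi_unif_mem n))
    intro y hy hcon
    simp only [Set.mem_ofPred_eq] at hy
    rw [Finset.filter_false_of_mem fun i _ => not_lt.2 (hcon i).2] at hy
    simp at hy
    omega

lemma measure_card_Ioi_lt_le {n b : ℕ} (hb : b ≤ n) {l s : ℝ} (h0 : 0 ≤ l) (h1 : l ≤ 1)
    (hs : 0 ≤ s) (hl : l ≤ ceThreshold (n + 1) b - s ∨ l = 0) :
    (Measure.pi fun _ : Fin n => unif) {y | (Finset.univ.filter fun i => l < y i).card < b} ≤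
      ENNReal.ofReal (Real.exp (-2 * n * s ^ 2)) := by
  rcases hl with hl | rfl
  · refine le_trans (measure_mono fun y hy => ?_)
      (measure_count_ge_le (n := n) (measurableSet_Iic (a := l)) (unif_real_Iic h0 h1).le hs)
    simp only [Set.mem_ofPred_eq] at hy ⊢
    have hsum : ∑ i, (Set.Iic l).indicator (1 : ℝ → ℝ) (y i)
        = n - (Finset.univ.filter fun i => l < y i).card := by
      rw [card_Ioi_eq_sum, eq_sub_iff_add_eq, ← Finset.sum_add_distrib]
      calc _ = ∑ _i : Fin n, (1 : ℝ) := Finset.sum_congr rfl fun i _ => by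
            rcases le_or_gt (y i) l with h | h <;> simp [h]
        _ = n := by simp
    rw [hsum]
    have hy' : ((Finset.univ.filter fun i => l < y i).card : ℝ) + 1 ≤ b := by exact_mod_cast hy
    have h2 := mul_ceThreshold n b
    have h3 : (n : ℝ) * l ≤ n * (ceThreshold (n + 1) b - s) := by gcongr
    have h4 : (b : ℝ) / (n + 1) ≤ 1 := by
      rw [div_le_one (by positivity)]
      have : (b : ℝ) ≤ n := by exact_mod_cast hb
      linarith
    nlinarith
  · refine le_of_eq_of_le ?_ zero_le
    have hpos : ∀ᵐ y ∂(Measure.pi fun _ : Fin n => unif), ∀ i, 0 < y i := by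
      refine ae_all_iff.2 fun i =>
        (measurePreserving_eval (fun _ : Fin n => unif) i).quasiMeasurePreserving.ae ?_
      filter_upwards [ae_unif_mem, Measure.ae_ne unif 0] with a ha ha'
      exact lt_of_le_of_ne ha.1 (Ne.symm ha')
    refine measure_mono_null ?_ (ae_iff.1 hpos)
    intro y hy hcon
    simp only [Set.mem_ofPred_eq] at hy
    rw [Finset.filter_true_of_mem fun i _ => hcon i] at hy
    simp at hy
    omega

/-- The expected loss of the decision on the first of `n + 1` candidates is at most `ε`, with an
integrable bound that decouples this candidate from the remaining ones. -/
def HasStepBound (f : ℝ → ℝ) (n : ℕ) (c : ℝ) (b : ℕ) (ε : ENNReal) : Prop :=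
  ∃ (v : ℝ → ENNReal) (w : (Fin n → ℝ) → ENNReal), Measurable v ∧ Measurable w ∧
    (∀ᵐ a ∂unif, ∀ y : Fin n → ℝ, ENNReal.ofReal (stepLoss f c b a y) ≤ v a + w y) ∧
    ∫⁻ a, v a ∂unif + ∫⁻ y, w y ∂(Measure.pi fun _ => unif) ≤ ε

lemma HasStepBound.mono {f : ℝ → ℝ} {n : ℕ} {c : ℝ} {b : ℕ} {ε ε' : ENNReal}
    (h : HasStepBound f n c b ε) (hε : ε ≤ ε') : HasStepBound f n c b ε' := by
  obtain ⟨v, w, hv, hw, h1, h2⟩ := h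
  exact ⟨v, w, hv, hw, h1, h2.trans hε⟩

lemma hasStepBound_zero_budget (f : ℝ → ℝ) (n : ℕ) (c : ℝ) : HasStepBound f n c 0 0 :=
  ⟨0, 0, measurable_const, measurable_const,
    Filter.Eventually.of_forall fun a y => by simp [stepLoss_zero], by simp⟩

lemma hasStepBound_large_budget {f : ℝ → ℝ} (hf0 : ∀ x, 0 ≤ f x) {n : ℕ} {c : ℝ} {b : ℕ}
    (hb : n < b) (hc : c ≤ 0) : HasStepBound f n c b 0 := by
  refine ⟨0, 0, measurable_const, measurable_const, ?_, by simp⟩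
  filter_upwards [ae_unif_mem] with a ha y
  simpa using stepLoss_nonpos hf0 hb (hc.trans ha.1) y

lemma hasStepBound_of_window {f : ℝ → ℝ} (hf : Monotone f) (hf0 : ∀ x, 0 ≤ f x)
    (hf1 : ∀ x, f x ≤ 1) {n b : ℕ} (hb1 : 1 ≤ b) (hbn : b ≤ n) {l c h K s : ℝ}
    (hl0 : 0 ≤ l) (hlc : l ≤ c) (hch : c ≤ h) (hh1 : h ≤ 1) (hK : 0 ≤ K) (hs : 0 ≤ s)
    (hl : l ≤ ceThreshold (n + 1) b - s ∨ l = 0) (hh : ceThreshold (n + 1) b + s ≤ h ∨ h = 1)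
    (h1 : ∀ x ∈ Set.Ioc l c, ∀ x' ∈ Set.Ioc l c, f x - f x' ≤ K)
    (h2 : ∀ x ∈ Set.Ioc c h, ∀ x' ∈ Set.Ioc c h, f x - f x' ≤ K) :
    HasStepBound f n c b (ENNReal.ofReal (K * (h - l) + 2 * Real.exp (-2 * n * s ^ 2))) := by
  classical
  set E1 : Set (Fin n → ℝ) := {y | b ≤ (Finset.univ.filter fun i => h < y i).card}
  set E2 : Set (Fin n → ℝ) := {y | (Finset.univ.filter fun i => l < y i).card < b}
  have hcount : ∀ u : ℝ, Measurable fun y : Fin n → ℝ =>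
      ((Finset.univ.filter fun i => u < y i).card : ℝ) := fun u => by
    simp_rw [card_Ioi_eq_sum]
    exact Finset.measurable_sum _ fun i _ =>
      (measurable_one.indicator measurableSet_Ioi).comp (measurable_pi_apply i)
  have hE1 : MeasurableSet E1 := by
    have := measurableSet_le (measurable_const (a := (b : ℝ))) (hcount h)
    simpa only [Nat.cast_le] using this
  have hE2 : MeasurableSet E2 := by
    have := measurableSet_lt (hcount l) (measurable_const (a := (b : ℝ)))
    simpa only [Nat.cast_lt] using this
  -- Off `E1 ∪ E2` the marginal candidate lies in the window and `stepLoss_le` applies; on it the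
  -- loss is at most `1`.
  refine ⟨(Set.Ioc l h).indicator fun _ => ENNReal.ofReal K, (E1 ∪ E2).indicator fun _ => 1,
    measurable_const.indicator measurableSet_Ioc, measurable_const.indicator (hE1.union hE2),
    ?_, ?_⟩
  · filter_upwards [Measure.ae_ne unif c] with a ha y
    by_cases hy : y ∈ E1 ∪ E2
    · rw [Set.indicator_of_mem hy]
      refine le_trans ?_ le_add_self
      simpa using stepLoss_le_one hf0 hf1 c b a y
    · rw [Set.indicator_of_notMem hy, add_zero]
      simp only [E1, E2, Set.mem_union, Set.mem_ofPred_eq, not_or, not_le, not_lt] at hy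
      have := stepLoss_le hf hf0 hlc hch hK h1 h2 ha y hy.1 hy.2
      refine (ENNReal.ofReal_le_ofReal this).trans ?_
      by_cases ham : a ∈ Set.Ioc l h
      · rw [Set.indicator_of_mem ham, Set.indicator_of_mem ham]
      · rw [Set.indicator_of_notMem ham, Set.indicator_of_notMem ham, ENNReal.ofReal_zero]
  · rw [lintegral_indicator_const measurableSet_Ioc, lintegral_indicator_const (hE1.union hE2),
      one_mul, ENNReal.ofReal_add (mul_nonneg hK (by linarith)) (by positivity),
      ENNReal.ofReal_mul hK, two_mul, ENNReal.ofReal_add (by positivity) (by positivity)]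
    refine add_le_add (mul_le_mul_right unif_Ioc_le _) ((measure_union_le _ _).trans ?_)
    exact add_le_add (measure_le_card_Ioi_le hb1 (by linarith) hh1 hs hh)
      (measure_card_Ioi_lt_le hbn hl0 (by linarith) hs hl)

lemma lintegral_static_loss_le {f : ℝ → ℝ} (hf : Monotone f) (hf0 : ∀ x, 0 ≤ f x)
    (hf1 : ∀ x, f x ≤ 1) (n b : ℕ) :
    ∫⁻ x : Fin n → ℝ, ENNReal.ofReal (offline b (fun i => f (x i)) -
        ∑ i ∈ hired (fun _ _ => ceThreshold n b) x b, f (x i)) ∂(Measure.pi fun _ => unif) ≤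
      ENNReal.ofReal (Real.sqrt n) := by
  rcases le_or_gt n b with hb | hb
  · refine le_of_eq_of_le (lintegral_eq_zero_of_ae_eq_zero ?_) zero_le
    filter_upwards [ae_pi_unif_mem n] with x hx
    simp only [Pi.zero_apply, ENNReal.ofReal_eq_zero]
    refine static_loss_nonpos hb hf0 x fun i => le_trans ?_ (hx i).1
    have hn : (0 : ℝ) < n := by exact_mod_cast i.pos
    rw [ceThreshold, sub_nonpos, one_le_div hn]
    exact_mod_cast hb
  · have hn : 0 < n := by omega
    have hn' : (0 : ℝ) < n := by exact_mod_cast hn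
    have hbn : (b : ℝ) / n ≤ 1 := by
      rw [div_le_one hn']; exact_mod_cast hb.le
    have hb0 : (0 : ℝ) ≤ b / n := by positivity
    refine le_trans (lintegral_mono fun x => ENNReal.ofReal_le_ofReal
      (static_loss_le hf hf0 hf1 (ceThreshold n b) x)) ?_
    have h := lintegral_abs_count_sub_le (ν := unif) hn
      (measurableSet_Ici (a := ceThreshold n b)) (c := b) (by
        rw [unif_real_Ici (by rw [ceThreshold]; linarith) (by rw [ceThreshold]; linarith),
          ceThreshold]
        field_simp
        ring)
    refine le_trans (le_of_eq ?_) h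
    refine lintegral_congr fun x => ?_
    rw [← card_filter_eq_sum_indicator (Set.Ici (ceThreshold n b)) x]
    rfl

/-- Induction on the length of the first phase. Given the first candidate, the rest is an instance
with a budget determined by that candidate, and the induction hypothesis is uniform in the budget.
The split `v a + w y` allows separate integration without measurability of the loss itself. -/
theorem lintegral_twoPhaseLoss_le {f : ℝ → ℝ} (hf : Monotone f) (hf0 : ∀ x, 0 ≤ f x)
    (hf1 : ∀ x, f x ≤ 1) {m : ℕ} {p : ℕ → ℕ → ℝ} {ℓ : ℕ → ENNReal}
    {k : ℕ} (hstep : ∀ n, m ≤ n → n < m + k → ∀ b, HasStepBound f n (p (n + 1) b) b (ℓ n))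
    (b : ℕ) :
    ∫⁻ x : Fin (m + k) → ℝ, ENNReal.ofReal (twoPhaseLoss f k p b x)
        ∂(Measure.pi fun _ => unif) ≤
      ∑ n ∈ Finset.Ico m (m + k), ℓ n + ENNReal.ofReal (Real.sqrt m) := by
  induction k generalizing b with
  | zero =>
    simp only [twoPhaseLoss, twoPhase_zero]
    refine (lintegral_static_loss_le hf hf0 hf1 (m + 0) b).trans ?_
    simp
  | succ k ih =>
    obtain ⟨v, w, hv, hw, hvw, hle⟩ := hstep (m + k) (by omega) (by omega) b
    have ih := ih fun n h1 h2 => hstep n h1 (by omega)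
    set R := ∑ n ∈ Finset.Ico m (m + k), ℓ n + ENNReal.ofReal (Real.sqrt m)
    refine (lintegral_pi_succ (ν := unif) (m + k) _).trans ?_
    calc ∫⁻ a, ∫⁻ y : Fin (m + k) → ℝ,
          ENNReal.ofReal (twoPhaseLoss f (k + 1) p b (Fin.cons a y : Fin (m + k + 1) → ℝ))
            ∂(Measure.pi fun _ => unif) ∂unif
        ≤ ∫⁻ a, (v a + (∫⁻ y, w y ∂(Measure.pi fun _ => unif) + R)) ∂unif := by
          refine lintegral_mono_ae ?_
          filter_upwards [hvw] with a ha
          calc _ ≤ ∫⁻ y : Fin (m + k) → ℝ, ((v a + w y) + ENNReal.ofReal (twoPhaseLoss f k p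
                  (if p (m + k + 1) b ≤ a ∧ 0 < b then b - 1 else b) y))
                  ∂(Measure.pi fun _ => unif) := by
                refine lintegral_mono fun y => ?_
                rw [twoPhaseLoss_cons]
                exact ENNReal.ofReal_add_le.trans (add_le_add_left (ha y) _)
            _ = v a + ∫⁻ y, w y ∂(Measure.pi fun _ => unif) + _ := by
                rw [lintegral_add_left (by fun_prop), lintegral_add_left measurable_const,
                  lintegral_const, measure_univ, mul_one]
            _ ≤ _ := by
                rw [add_assoc]
                exact add_le_add_right (add_le_add_right (ih _) _) _
      _ = ∫⁻ a, v a ∂unif + (∫⁻ y, w y ∂(Measure.pi fun _ => unif) + R) := by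
          rw [lintegral_add_left hv, lintegral_const, measure_univ, mul_one]
      _ ≤ ℓ (m + k) + R := by
          rw [← add_assoc]
          exact add_le_add_left hle _
      _ = _ := by
          rw [← add_assoc m k 1, Finset.sum_Ico_succ_top (by omega)]
          simp only [R]
          ring

/-! ### The quantile function and the distributional transform -/

section Quantile

variable {P : Measure ℝ}

variable (P) in
/-- The left limit `F(θ-)` of the distribution function. -/
noncomputable def cdfLeft (θ : ℝ) : ℝ := Function.leftLim (cdf P) θ

lemma cdfLeft_le (θ : ℝ) : cdfLeft P θ ≤ cdf P θ := (monotone_cdf P).leftLim_le le_rfl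

lemma cdf_le_cdfLeft {v θ : ℝ} (h : v < θ) : cdf P v ≤ cdfLeft P θ := (monotone_cdf P).le_leftLim h

lemma cdfLeft_le_of_forall {θ c : ℝ} (h : ∀ v < θ, cdf P v ≤ c) : cdfLeft P θ ≤ c := by
  refine le_of_tendsto ((monotone_cdf P).tendsto_leftLim θ) ?_
  filter_upwards [self_mem_nhdsWithin] with v hv using h v hv

lemma cdfLeft_nonneg (θ : ℝ) : 0 ≤ cdfLeft P θ :=
  (cdf_nonneg P (θ - 1)).trans (cdf_le_cdfLeft (by linarith))

variable (P) in
/-- The distributional transform: a uniformly chosen point of `[F(θ-), F(θ)]`. -/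
noncomputable def distTransform (z : ℝ × ℝ) : ℝ :=
  cdfLeft P z.1 + z.2 * (cdf P z.1 - cdfLeft P z.1)

lemma measurable_distTransform : Measurable (distTransform P) := by
  have h1 : Measurable (cdfLeft P) := (monotone_cdf P).leftLim.measurable
  have h2 : Measurable (cdf P) := (monotone_cdf P).measurable
  exact (h1.comp measurable_fst).add
    (measurable_snd.mul ((h2.comp measurable_fst).sub (h1.comp measurable_fst)))

lemma cdfLeft_le_distTransform {z : ℝ × ℝ} (hz : 0 ≤ z.2) :
    cdfLeft P z.1 ≤ distTransform P z :=
  le_add_of_nonneg_right (mul_nonneg hz (sub_nonneg.2 (cdfLeft_le _)))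

lemma distTransform_le_cdf {z : ℝ × ℝ} (hz : z.2 ≤ 1) :
    distTransform P z ≤ cdf P z.1 := by
  have := mul_le_mul_of_nonneg_right hz (sub_nonneg.2 (cdfLeft_le (P := P) z.1))
  rw [distTransform]
  linarith

lemma ae_snd_mem : ∀ᵐ z ∂(P.prod unif), z.2 ∈ Set.Icc (0 : ℝ) 1 :=
  Measure.quasiMeasurePreserving_snd.ae ae_unif_mem

lemma ae_distTransform_mem : ∀ᵐ z ∂(P.prod unif), distTransform P z ∈ Set.Icc (0 : ℝ) 1 := by
  filter_upwards [ae_snd_mem (P := P)] with z hz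
  exact ⟨(cdfLeft_nonneg _).trans (cdfLeft_le_distTransform hz.1),
    (distTransform_le_cdf hz.2).trans (cdf_le_one P _)⟩

variable [IsProbabilityMeasure P]

lemma ae_mem_Icc (hP : P (Set.Icc (0 : ℝ) 1) = 1) : ∀ᵐ θ ∂P, θ ∈ Set.Icc (0 : ℝ) 1 :=
  (mem_ae_iff_prob_eq_one measurableSet_Icc).2 hP

lemma cdf_one (hP : P (Set.Icc (0 : ℝ) 1) = 1) : cdf P 1 = 1 := by
  have h : P (Set.Iic 1) = 1 :=
    le_antisymm prob_le_one (hP.symm.le.trans (measure_mono Set.Icc_subset_Iic_self))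
  rw [cdf_eq_real, measureReal_def, h, ENNReal.toReal_one]

lemma cdf_of_neg (hP : P (Set.Icc (0 : ℝ) 1) = 1) {v : ℝ} (hv : v < 0) : cdf P v = 0 := by
  have h : P (Set.Iic v) = 0 := by
    refine measure_mono_null ?_ (ae_iff.1 (ae_mem_Icc hP))
    intro θ hθ hcon
    exact absurd (hcon.1.trans hθ) (not_le.2 hv)
  rw [cdf_eq_real, measureReal_def, h, ENNReal.toReal_zero]

lemma quantile_mem_Icc (hP : P (Set.Icc (0 : ℝ) 1) = 1) {q : ℝ} (hq : q ≤ 1) :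
    quantile P q ∈ Set.Icc (0 : ℝ) 1 := by
  have h1 : (1 : ℝ) ∈ {v : ℝ | v ∈ Set.Icc (0 : ℝ) 1 ∧ q ≤ cdf P v} :=
    ⟨⟨zero_le_one, le_rfl⟩, by rw [cdf_one hP]; exact hq⟩
  exact ⟨le_csInf ⟨1, h1⟩ fun v hv => hv.1.1, csInf_le ⟨0, fun v hv => hv.1.1⟩ h1⟩

lemma quantile_le_iff (hP : P (Set.Icc (0 : ℝ) 1) = 1) {q v : ℝ} (hq : q ≤ 1)
    (hv : v ∈ Set.Icc (0 : ℝ) 1) : quantile P q ≤ v ↔ q ≤ cdf P v := by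
  set S := {v : ℝ | v ∈ Set.Icc (0 : ℝ) 1 ∧ q ≤ cdf P v}
  have hbdd : BddBelow S := ⟨0, fun v hv => hv.1.1⟩
  have hne : S.Nonempty := ⟨1, ⟨zero_le_one, le_rfl⟩, by rw [cdf_one hP]; exact hq⟩
  constructor
  · intro h
    have hq' : q ≤ cdf P (sInf S) := by
      refine ge_of_tendsto (((cdf P).right_continuous (sInf S)).tendsto.mono_left
        (nhdsWithin_mono _ Set.Ioi_subset_Ici_self)) ?_
      filter_upwards [self_mem_nhdsWithin] with w hw
      obtain ⟨v, hv, hvw⟩ := (csInf_lt_iff hbdd hne).1 hw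
      exact hv.2.trans (monotone_cdf P hvw.le)
    exact hq'.trans (monotone_cdf P h)
  · intro h
    exact csInf_le hbdd ⟨hv, h⟩

lemma le_cdf_quantile (hP : P (Set.Icc (0 : ℝ) 1) = 1) {q : ℝ} (hq : q ≤ 1) :
    q ≤ cdf P (quantile P q) :=
  (quantile_le_iff hP hq (quantile_mem_Icc hP hq)).1 le_rfl

lemma quantile_mono (hP : P (Set.Icc (0 : ℝ) 1) = 1) {q q' : ℝ} (h : q ≤ q') (hq' : q' ≤ 1) :
    quantile P q ≤ quantile P q' :=
  (quantile_le_iff hP (h.trans hq') (quantile_mem_Icc hP hq')).2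
    (h.trans (le_cdf_quantile hP hq'))

lemma cdf_lt_of_lt_quantile (hP : P (Set.Icc (0 : ℝ) 1) = 1) {q v : ℝ} (hq : q ≤ 1)
    (hv0 : 0 ≤ v) (hv : v < quantile P q) : cdf P v < q := by
  by_contra! h
  exact not_le.2 hv ((quantile_le_iff hP hq
    ⟨hv0, hv.le.trans (quantile_mem_Icc hP hq).2⟩).2 h)

lemma measure_Iio_eq (θ : ℝ) : P (Set.Iio θ) = ENNReal.ofReal (cdfLeft P θ) := by
  conv_lhs => rw [← measure_cdf P]
  rw [StieltjesFunction.measure_Iio _ (tendsto_cdf_atBot P), sub_zero, cdfLeft]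

lemma measure_singleton_eq (θ : ℝ) : P {θ} = ENNReal.ofReal (cdf P θ - cdfLeft P θ) := by
  conv_lhs => rw [← measure_cdf P]
  rw [StieltjesFunction.measure_singleton, cdfLeft]

lemma cdfLeft_quantile_le (hP : P (Set.Icc (0 : ℝ) 1) = 1) {q : ℝ} (hq0 : 0 ≤ q) (hq : q ≤ 1) :
    cdfLeft P (quantile P q) ≤ q := by
  refine cdfLeft_le_of_forall fun v hv => ?_
  rcases lt_or_ge v 0 with h | h
  · rw [cdf_of_neg hP h]; exact hq0
  · exact (cdf_lt_of_lt_quantile hP hq h hv).le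

/-- The mass strictly below the quantile, plus the fraction of its atom that the seed assigns to
levels up to `q`, is exactly `q`. -/
lemma measure_fiber (hP : P (Set.Icc (0 : ℝ) 1) = 1) {q : ℝ} (hq0 : 0 ≤ q) (hq : q ≤ 1) :
    ENNReal.ofReal (cdfLeft P (quantile P q)) + P {quantile P q} *
      unif {u | cdfLeft P (quantile P q) +
        u * (cdf P (quantile P q) - cdfLeft P (quantile P q)) ≤ q} = ENNReal.ofReal q := by
  have h1 := cdfLeft_quantile_le hP hq0 hq
  have h2 := le_cdf_quantile hP hq
  rw [measure_singleton_eq]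
  set a := cdfLeft P (quantile P q)
  set b := cdf P (quantile P q)
  have ha : 0 ≤ a := cdfLeft_nonneg _
  rcases (cdfLeft_le (P := P) (quantile P q)).lt_or_eq with h | h
  · have hab : 0 < b - a := sub_pos.2 h
    have hset : {u : ℝ | a + u * (b - a) ≤ q} = Set.Iic ((q - a) / (b - a)) := by
      ext u
      rw [Set.mem_ofPred_eq, Set.mem_Iic, le_div_iff₀ hab]
      constructor <;> intro h <;> linarith
    rw [hset, unif_Iic (by rw [div_le_one hab]; linarith), ← ENNReal.ofReal_mul hab.le,
      mul_div_cancel₀ _ hab.ne', ← ENNReal.ofReal_add ha (by linarith)]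
    congr 1
    ring
  · have hab : b - a = 0 := sub_eq_zero.2 h.symm
    have : a = q := le_antisymm h1 (h2.trans h.symm.le)
    rw [hab, ENNReal.ofReal_zero, zero_mul, add_zero, this]

lemma measure_distTransform_lt_le (hP : P (Set.Icc (0 : ℝ) 1) = 1) {q : ℝ} (hq0 : 0 ≤ q)
    (hq : q ≤ 1) : (P.prod unif) {z | distTransform P z < q} ≤ ENNReal.ofReal q := by
  set θ₀ := quantile P q
  set E : Set ℝ := {u | cdfLeft P θ₀ + u * (cdf P θ₀ - cdfLeft P θ₀) ≤ q}
  have hle : (P.prod unif) {z | distTransform P z < q} ≤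
      (P.prod unif) (Set.Iio θ₀ ×ˢ Set.univ ∪ {θ₀} ×ˢ E) := by
    refine measure_mono_ae ?_
    filter_upwards [ae_snd_mem (P := P)] with z hz hzq
    rcases lt_trichotomy z.1 θ₀ with h | h | h
    · exact Or.inl ⟨h, trivial⟩
    · refine Or.inr ⟨h, ?_⟩
      have := le_of_lt hzq
      rw [distTransform, h] at this
      exact this
    · exact absurd hzq (not_lt.2 ((le_cdf_quantile hP hq).trans
        ((cdf_le_cdfLeft h).trans (cdfLeft_le_distTransform hz.1))))
  refine hle.trans ((measure_union_le _ _).trans ?_)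
  rw [Measure.prod_prod, Measure.prod_prod, measure_univ, mul_one, measure_Iio_eq,
    measure_fiber hP hq0 hq]

lemma le_measure_distTransform_le (hP : P (Set.Icc (0 : ℝ) 1) = 1) {q : ℝ} (hq0 : 0 ≤ q)
    (hq : q ≤ 1) : ENNReal.ofReal q ≤ (P.prod unif) {z | distTransform P z ≤ q} := by
  set θ₀ := quantile P q
  set E : Set ℝ := {u | cdfLeft P θ₀ + u * (cdf P θ₀ - cdfLeft P θ₀) ≤ q}
  have hE : MeasurableSet E := measurableSet_le (by fun_prop) measurable_const
  have hle : (P.prod unif) (Set.Iio θ₀ ×ˢ Set.univ ∪ {θ₀} ×ˢ E) ≤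
      (P.prod unif) {z | distTransform P z ≤ q} := by
    refine measure_mono_ae ?_
    filter_upwards [ae_snd_mem (P := P)] with z hz hzq
    rcases hzq with h | h
    · exact (distTransform_le_cdf hz.2).trans ((cdf_le_cdfLeft h.1).trans
        (cdfLeft_quantile_le hP hq0 hq))
    · have h1 : z.1 = θ₀ := h.1
      have h2 : z.2 ∈ E := h.2
      change distTransform P z ≤ q
      rw [distTransform, h1]
      exact h2
  refine le_trans (le_of_eq ?_) hle
  rw [measure_union ?_ ((measurableSet_singleton _).prod hE), Measure.prod_prod,
    Measure.prod_prod, measure_univ, mul_one, measure_Iio_eq, measure_fiber hP hq0 hq]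
  rw [Set.disjoint_left]
  rintro z ⟨h, _⟩ ⟨h', _⟩
  exact absurd h' (ne_of_lt h)

theorem measurePreserving_distTransform (hP : P (Set.Icc (0 : ℝ) 1) = 1) :
    MeasurePreserving (distTransform P) (P.prod unif) unif := by
  refine ⟨measurable_distTransform, ?_⟩
  have : IsProbabilityMeasure ((P.prod unif).map (distTransform P)) :=
    Measure.isProbabilityMeasure_map measurable_distTransform.aemeasurable
  refine Measure.ext_of_Iic _ _ fun q => ?_
  rw [Measure.map_apply measurable_distTransform measurableSet_Iic]
  rcases le_or_gt 1 q with h1 | h1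
  · have e1 : (P.prod unif) (distTransform P ⁻¹' Set.Iic q) = 1 := by
      rw [← mem_ae_iff_prob_eq_one (measurable_distTransform measurableSet_Iic)]
      filter_upwards [ae_distTransform_mem (P := P)] with z hz using hz.2.trans h1
    have e2 : unif (Set.Iic q) = 1 := by
      rw [← mem_ae_iff_prob_eq_one measurableSet_Iic]
      filter_upwards [ae_unif_mem] with z hz using hz.2.trans h1
    rw [e1, e2]
  · rw [unif_Iic h1.le]
    rcases lt_or_ge q 0 with h0 | h0
    · rw [ENNReal.ofReal_of_nonpos h0.le]
      refine measure_mono_null ?_ (ae_iff.1 (ae_distTransform_mem (P := P)))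
      intro z hz hcon
      exact absurd (hcon.1.trans hz) (not_le.2 h0)
    · refine le_antisymm ?_ (le_measure_distTransform_le hP h0 h1.le)
      -- The upper bound is known for `{· < q}` only, so it is applied at a level slightly above
      -- `q`.
      refine ENNReal.le_of_forall_pos_le_add fun ε hε _ => ?_
      have h3 : ENNReal.ofReal (min 1 (q + ε)) ≤ ENNReal.ofReal q + ε := by
        rw [← ENNReal.ofReal_coe_nnreal, ← ENNReal.ofReal_add h0 ε.coe_nonneg]
        exact ENNReal.ofReal_le_ofReal (min_le_right _ _)
      refine le_trans (le_trans (measure_mono fun z hz => ?_)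
        (measure_distTransform_lt_le hP (q := min 1 (q + ε)) (le_min zero_le_one (by positivity))
          (min_le_left _ _))) h3
      have hε' : (0 : ℝ) < ε := hε
      exact lt_min (lt_of_le_of_lt hz h1) (lt_of_le_of_lt hz (by linarith))

/-- At an atom `θ`, `quantileSet` is `[F(θ-), F(θ)]` up to its left endpoint. Otherwise it is the
point `F(θ)`, unless `F` is flat just to the left of `θ`; then `F(θ)` is also the value of `F` at a
rational, which the uniformly distributed transform almost surely avoids. -/
theorem ae_quantileSample (hP : P (Set.Icc (0 : ℝ) 1) = 1) : ∀ᵐ z ∂(P.prod unif),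
    quantileSample P z.1 z.2 = distTransform P z ∧ quantile P (distTransform P z) = z.1 := by
  have hne : ∀ᵐ z ∂(P.prod unif), ∀ r : ℚ, distTransform P z ≠ cdf P r :=
    ae_all_iff.2 fun r => (measurePreserving_distTransform hP).quasiMeasurePreserving.ae
      (Measure.ae_ne unif (cdf P r))
  have h01 : ∀ᵐ z ∂(P.prod unif), z.2 ∈ Set.Ioo (0 : ℝ) 1 := by
    refine Measure.quasiMeasurePreserving_snd.ae (p := fun u => u ∈ Set.Ioo (0 : ℝ) 1) ?_
    filter_upwards [ae_unif_mem, Measure.ae_ne unif 0, Measure.ae_ne unif 1] with u hu h0 h1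
    exact ⟨lt_of_le_of_ne hu.1 (Ne.symm h0), lt_of_le_of_ne hu.2 h1⟩
  have hθ : ∀ᵐ z ∂(P.prod unif), z.1 ∈ Set.Icc (0 : ℝ) 1 :=
    Measure.quasiMeasurePreserving_fst.ae (ae_mem_Icc hP)
  filter_upwards [hne, h01, hθ] with z hne hu hθ
  obtain ⟨θ, u⟩ := z
  simp only at hu hθ ⊢
  have hsub : quantileSet P θ ⊆ Set.Icc (cdfLeft P θ) (cdf P θ) := by
    rintro q ⟨hq, rfl⟩
    exact ⟨cdfLeft_quantile_le hP hq.1 hq.2, le_cdf_quantile hP hq.2⟩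
  have hlt : ∀ q ∈ Set.Ioc (cdfLeft P θ) (cdf P θ), q ∈ quantileSet P θ := by
    intro q hq
    have hq1 : q ≤ 1 := hq.2.trans (cdf_le_one P θ)
    refine ⟨⟨(cdfLeft_nonneg _).trans hq.1.le, hq1⟩, le_antisymm ?_ ?_⟩
    · exact (quantile_le_iff hP hq1 hθ).2 hq.2
    · by_contra! h
      exact absurd (le_cdf_quantile hP hq1)
        (not_le.2 ((cdf_le_cdfLeft h).trans_lt hq.1))
  rcases (cdfLeft_le (P := P) θ).lt_or_eq with h | h
  · have hinf : sInf (quantileSet P θ) = cdfLeft P θ := by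
      apply le_antisymm
      · rw [← csInf_Ioc h]
        exact csInf_le_csInf ⟨_, fun q hq => (hsub hq).1⟩ (Set.nonempty_Ioc.2 h) hlt
      · exact le_csInf ((Set.nonempty_Ioc.2 h).mono hlt) fun q hq => (hsub hq).1
    have hsup : sSup (quantileSet P θ) = cdf P θ := by
      apply le_antisymm
      · exact csSup_le ((Set.nonempty_Ioc.2 h).mono hlt) fun q hq => (hsub hq).2
      · exact le_csSup ⟨_, fun q hq => (hsub hq).2⟩ (hlt _ ⟨h, le_rfl⟩)
    refine ⟨by rw [quantileSample, hinf, hsup]; rfl, ?_⟩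
    refine (hlt _ ⟨?_, distTransform_le_cdf hu.2.le⟩).2
    exact lt_add_of_pos_right _ (mul_pos hu.1 (sub_pos.2 h))
  · have hG : distTransform P (θ, u) = cdf P θ := by simp [distTransform, h]
    rw [hG] at hne ⊢
    have hq : quantile P (cdf P θ) = θ := by
      apply le_antisymm ((quantile_le_iff hP (cdf_le_one P θ) hθ).2 le_rfl)
      by_contra! hcon
      obtain ⟨r, hr1, hr2⟩ := exists_rat_btwn hcon
      refine hne r (le_antisymm ?_ (monotone_cdf P hr2.le))
      exact (le_cdf_quantile hP (cdf_le_one P θ)).trans (monotone_cdf P hr1.le)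
    have hset : quantileSet P θ = {cdf P θ} := by
      refine Set.Subset.antisymm (fun q hq => ?_) ?_
      · have := hsub hq
        rw [h, Set.Icc_self] at this
        exact this
      · rintro _ rfl
        exact ⟨⟨cdf_nonneg P θ, cdf_le_one P θ⟩, hq⟩
    refine ⟨?_, hq⟩
    rw [quantileSample, hset, csInf_singleton, csSup_singleton, sub_self, mul_zero, add_zero]

end Quantile

/-! ### From sample paths to uniform quantiles -/

lemma measurable_eval_nat {Ω : Type*} [MeasurableSpace Ω] {h : Ω → ℕ → ℝ}
    (hh : ∀ b, Measurable fun ω => h ω b) {N : Ω → ℕ} (hN : Measurable N) :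
    Measurable fun ω => h ω (N ω) := by
  have : Measurable fun z : Ω × ℕ => h z.1 z.2 := measurable_from_prod_countable_left hh
  exact this.comp (measurable_id.prodMk hN)

lemma measurable_budget {Ω : Type*} [MeasurableSpace Ω] {T : ℕ} {thr : Ω → ℕ → ℕ → ℝ}
    {x : Ω → Fin T → ℝ} (hthr : ∀ t b, Measurable fun ω => thr ω t b) (hx : Measurable x)
    (B t : ℕ) : Measurable fun ω => budget (thr ω) (x ω) B t := by
  induction t with
  | zero => exact measurable_const
  | succ t ih =>
    simp only [budget]
    by_cases ht : t < T
    · simp only [dif_pos ht]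
      refine Measurable.ite ?_ ((measurable_from_top (f := fun n : ℕ => n - 1)).comp ih) ih
      exact (measurableSet_le (measurable_eval_nat (hthr t) ih)
        ((measurable_pi_apply (⟨t, ht⟩ : Fin T)).comp hx)).inter
        (measurableSet_lt measurable_const ih)
    · simp only [dif_neg ht]
      exact ih

lemma measurable_twoPhase {T : ℕ} (k : ℕ) (p : ℕ → ℕ → ℝ) (B t b : ℕ) :
    Measurable fun x : Fin T → ℝ => twoPhase k p x B t b := by
  unfold twoPhase
  split_ifs
  · exact measurable_const
  · exact (measurable_from_top (f := fun n : ℕ => ceThreshold (T - k) n)).comp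
      (measurable_budget (thr := fun _ s c => p (T - s) c) (fun _ _ => measurable_const)
        measurable_id B k)

lemma measurable_sup'_apply {Ω ι : Type*} [MeasurableSpace Ω] {s : Finset ι} (hs : s.Nonempty)
    {F : ι → Ω → ℝ} (hF : ∀ i ∈ s, Measurable (F i)) :
    Measurable fun ω => s.sup' hs fun i => F i ω := by
  have h : (fun ω => s.sup' hs fun i => F i ω) = s.sup' hs F := by
    funext ω
    rw [Finset.sup'_apply]
  rw [h]
  exact Finset.measurable_sup' hs hF

lemma measurable_offline {T : ℕ} (B : ℕ) {f : ℝ → ℝ} (hf : Measurable f) :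
    Measurable fun x : Fin T → ℝ => offline B (fun i => f (x i)) :=
  measurable_sup'_apply _ (F := fun s (x : Fin T → ℝ) => ∑ t ∈ s, f (x t)) fun _ _ =>
    Finset.measurable_sum _ fun i _ => hf.comp (measurable_pi_apply i)

lemma measurable_sum_hired {T : ℕ} (k : ℕ) (p : ℕ → ℕ → ℝ) (B : ℕ) {f : ℝ → ℝ}
    (hf : Measurable f) :
    Measurable fun x : Fin T → ℝ => ∑ i ∈ hired (twoPhase k p x B) x B, f (x i) := by
  simp_rw [sum_hired]
  refine Finset.measurable_sum _ fun i _ => ?_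
  have hb := measurable_budget (measurable_twoPhase (T := T) k p B) measurable_id B i
  refine Measurable.ite ?_ (hf.comp (measurable_pi_apply i)) measurable_const
  exact (measurableSet_le (measurable_eval_nat (measurable_twoPhase k p B i) hb)
    (measurable_pi_apply i)).inter (measurableSet_lt measurable_const hb)

/-- The quantile function, extended by the constant `F⁻¹(1)` beyond `1`. -/
noncomputable def quantileExt (P : Measure ℝ) (x : ℝ) : ℝ := quantile P (min x 1)

section

variable {P : Measure ℝ}

lemma quantileExt_of_le {x : ℝ} (hx : x ≤ 1) : quantileExt P x = quantile P x := by
  rw [quantileExt, min_eq_left hx]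

variable [IsProbabilityMeasure P]

/-- The truncation at `1` is what makes this hold on the whole line: for `q > 1`, `quantile P q` is
the infimum of the empty set, that is, `0`. -/
lemma quantileExt_mono (hP : P (Set.Icc (0 : ℝ) 1) = 1) : Monotone (quantileExt P) :=
  fun _ _ h => quantile_mono hP (min_le_min_right _ h) (min_le_right _ _)

lemma quantileExt_mem (hP : P (Set.Icc (0 : ℝ) 1) = 1) (x : ℝ) :
    quantileExt P x ∈ Set.Icc (0 : ℝ) 1 :=
  quantile_mem_Icc hP (min_le_right _ _)

theorem regret_cwg_le (hP : P (Set.Icc (0 : ℝ) 1) = 1) (ε₀ : ℝ) (p : ℕ → ℕ → ℝ) (T B : ℕ)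
    {R : ℝ} (hR : 0 ≤ R)
    (h : ∫⁻ x : Fin T → ℝ,
        ENNReal.ofReal (twoPhaseLoss (quantileExt P) (phaseOne T ε₀) p B x)
        ∂(Measure.pi fun _ => unif) ≤ ENNReal.ofReal R) :
    regret P T B (cwg P ε₀ p T B) ≤ R := by
  set f := quantileExt P
  set k := phaseOne T ε₀
  have hf : Measurable f := (quantileExt_mono hP).measurable
  set Ψ : Path T → Fin T → ℝ := fun ω t => distTransform P (ω t)
  have hΨ : MeasurePreserving Ψ (pathLaw P T) (Measure.pi fun _ => unif) :=
    measurePreserving_pi (fun _ : Fin T => P.prod unif) (fun _ => unif)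
      (f := fun _ => distTransform P) fun _ => measurePreserving_distTransform hP
  have : IsProbabilityMeasure (pathLaw P T) := by unfold pathLaw; infer_instance
  have hae : ∀ᵐ ω ∂(pathLaw P T), ∀ t, quantileSample P (ω t).1 (ω t).2 = Ψ ω t ∧
      f (Ψ ω t) = (ω t).1 := by
    refine ae_all_iff.2 fun t => ?_
    refine (measurePreserving_eval (fun _ : Fin T => P.prod unif) t).quasiMeasurePreserving.ae
      (p := fun z => quantileSample P z.1 z.2 = distTransform P z ∧ f (distTransform P z) = z.1) ?_
    filter_upwards [ae_quantileSample hP, ae_distTransform_mem (P := P)] with z hz hz'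
    exact ⟨hz.1, (quantileExt_of_le hz'.2).trans hz.2⟩
  set O : (Fin T → ℝ) → ℝ := fun x => offline B (fun i => f (x i))
  set W : (Fin T → ℝ) → ℝ := fun x => ∑ i ∈ hired (twoPhase k p x B) x B, f (x i)
  have hO : Measurable O := measurable_offline B hf
  have hW : Measurable W := measurable_sum_hired k p B hf
  have hf01 := quantileExt_mem hP
  have hOint : Integrable (fun ω => O (Ψ ω)) (pathLaw P T) :=
    Integrable.of_mem_Icc 0 T (hO.comp hΨ.measurable).aemeasurable
      (Filter.Eventually.of_forall fun ω =>
        ⟨offline_nonneg _ _, offline_le_card _ fun i => (hf01 _).2⟩)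
  have hWint : Integrable (fun ω => W (Ψ ω)) (pathLaw P T) := by
    refine Integrable.of_mem_Icc 0 T (hW.comp hΨ.measurable).aemeasurable
      (Filter.Eventually.of_forall fun ω => ⟨Finset.sum_nonneg fun i _ => (hf01 _).1, ?_⟩)
    calc W (Ψ ω) ≤ ∑ _i ∈ hired (twoPhase k p (Ψ ω) B) (Ψ ω) B, (1 : ℝ) :=
          Finset.sum_le_sum fun i _ => (hf01 _).2
      _ = (hired (twoPhase k p (Ψ ω) B) (Ψ ω) B).card := by simp
      _ ≤ T := by exact_mod_cast (Finset.card_le_univ _).trans (by simp)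
  have e1 : ∫ ω, offline B (fun t => (ω t).1) ∂pathLaw P T = ∫ ω, O (Ψ ω) ∂pathLaw P T := by
    refine integral_congr_ae ?_
    filter_upwards [hae] with ω hω
    simp only [O, (hω _).2]
  have e2 : ∫ ω, ∑ t ∈ cwg P ε₀ p T B ω, (ω t).1 ∂pathLaw P T
      = ∫ ω, W (Ψ ω) ∂pathLaw P T := by
    refine integral_congr_ae ?_
    filter_upwards [hae] with ω hω
    have hx : (fun t => quantileSample P (ω t).1 (ω t).2) = Ψ ω := funext fun t => (hω t).1
    simp only [W, (hω _).2, cwg_eq_hired, hx]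
    rfl
  have hint : Integrable (fun ω => O (Ψ ω) - W (Ψ ω)) (pathLaw P T) := hOint.sub hWint
  rw [regret, e1, e2, ← integral_sub hOint hWint,
    integral_eq_lintegral_pos_part_sub_lintegral_neg_part hint]
  refine (sub_le_self _ ENNReal.toReal_nonneg).trans (ENNReal.toReal_le_of_le_ofReal hR ?_)
  refine le_trans (le_of_eq ?_) h
  exact hΨ.lintegral_comp (f := fun x => ENNReal.ofReal (O x - W x)) (hO.sub hW).ennreal_ofReal

end

/-! ### The expected loss of a single conservative decision -/

/-- The radius within which a gap quantile is close to the certainty equivalent threshold. -/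
noncomputable def radius (τ : ℕ) : ℝ := Real.sqrt (2 * (Real.log τ / τ))

lemma radius_nonneg (τ : ℕ) : 0 ≤ radius τ := Real.sqrt_nonneg _

lemma radius_pos {τ : ℕ} (hτ : 2 ≤ τ) : 0 < radius τ := by
  have h : (1 : ℝ) < τ := by exact_mod_cast hτ
  have := Real.log_pos h
  exact Real.sqrt_pos.2 (by positivity)

lemma radius_sq (τ : ℕ) : radius τ ^ 2 = 2 * (Real.log τ / τ) :=
  Real.sq_sqrt (mul_nonneg zero_le_two (div_nonneg (Real.log_natCast_nonneg τ) (Nat.cast_nonneg τ)))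

lemma mem_nearGaps {n : ℕ} {g : Fin (n + 2) → ℝ} {τ b : ℕ} {i : Fin n} :
    i ∈ nearGaps g τ b ↔ |ceThreshold τ b - innerGap g i| < radius τ := by
  rw [nearGaps, Set.mem_ofPred_eq, Metric.mem_ball, Real.dist_eq, radius]

section Clustered

variable {P : Measure ℝ} {β ε₀ : ℝ} {n : ℕ} {g : Fin (n + 2) → ℝ}

lemma IsGapQuantiles.mem_Icc (hg : IsGapQuantiles P β ε₀ g) (i : Fin (n + 2)) :
    g i ∈ Set.Icc (0 : ℝ) 1 :=
  ⟨hg.zero ▸ hg.strictMono.monotone (Fin.zero_le i),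
    hg.last ▸ hg.strictMono.monotone (Fin.le_last i)⟩

lemma IsGapQuantiles.sub_le (hg : IsGapQuantiles P β ε₀ g) (hβ : 0 ≤ β) {i : Fin (n + 1)}
    {l h d : ℝ} (hl : g i.castSucc ≤ l) (hh : h ≤ g i.succ) (hd : h - l ≤ d) :
    ∀ x ∈ Set.Ioc l h, ∀ x' ∈ Set.Ioc l h,
      quantileExt P x - quantileExt P x' ≤ d ^ (1 / (β + 1)) := by
  intro x hx x' hx'
  have h1 := (hg.mem_Icc i.succ).2
  rw [quantileExt_of_le (hx.2.trans (hh.trans h1)), quantileExt_of_le (hx'.2.trans (hh.trans h1))]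
  refine (le_abs_self _).trans ((hg.density i x ⟨hl.trans_lt hx.1, hx.2.trans hh⟩ x'
    ⟨hl.trans_lt hx'.1, hx'.2.trans hh⟩).trans ?_)
  refine Real.rpow_le_rpow (abs_nonneg _) (abs_le.2 ⟨?_, ?_⟩) (by positivity)
  · linarith [hx.1, hx'.2]
  · linarith [hx.2, hx'.1]

/-- The cluster is the last one starting at or below `c`; its interior endpoints are gap quantiles,
hence at distance at least `r` from `c`. -/
lemma IsGapQuantiles.exists_cluster (hg : IsGapQuantiles P β ε₀ g) {c r : ℝ} (hc0 : 0 ≤ c)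
    (hfar : ∀ j : Fin n, r ≤ |c - innerGap g j|) :
    ∃ i : Fin (n + 1), g i.castSucc ≤ max (c - r) 0 ∧ min (c + r) 1 ≤ g i.succ := by
  classical
  obtain ⟨i, hi, hmax⟩ := Finset.exists_max_image
    (Finset.univ.filter fun i : Fin (n + 1) => g i.castSucc ≤ c) id ⟨0, by simpa [hg.zero] using hc0⟩
  simp only [Finset.mem_filter, Finset.mem_univ, true_and, id] at hi hmax
  refine ⟨i, ?_, ?_⟩
  · refine Fin.cases (fun _ => ?_) (fun j hj => ?_) i hi
    · simp [hg.zero]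
    · refine le_max_of_le_left ?_
      have h1 : innerGap g j = g j.succ.castSucc := rfl
      have h2 := hfar j
      rw [h1, abs_of_nonneg (by linarith)] at h2
      linarith
  · refine Fin.lastCases (fun _ => ?_) (fun j hj => ?_) i hmax
    · rw [Fin.succ_last, hg.last]; exact min_le_right _ _
    · refine min_le_of_left_le ?_
      have h1 : innerGap g j = g j.castSucc.succ := rfl
      have h3 : c < innerGap g j := by
        by_contra! h
        exact absurd (hj j.succ h) (not_le.2 Fin.castSucc_lt_succ)
      have h2 := hfar j
      rw [abs_of_neg (by linarith)] at h2
      rw [← h1]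
      linarith

lemma rpow_mul_le {r w α : ℝ} (hr : 0 < r) (hw : w ≤ 2 * r) :
    (2 * r) ^ α * w ≤ (2 * r) ^ (1 + α) := by
  rw [add_comm 1 α, Real.rpow_add_one (by positivity)]
  gcongr

variable [IsProbabilityMeasure P]

lemma hasStepBound_far (hP : P (Set.Icc (0 : ℝ) 1) = 1) (hg : IsGapQuantiles P β ε₀ g)
    (hβ : 0 ≤ β) {N b : ℕ} (hb1 : 1 ≤ b) (hbN : b ≤ N) (hfar : nearGaps g (N + 1) b = ∅) :
    HasStepBound (quantileExt P) N (ceThreshold (N + 1) b) b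
      (ENNReal.ofReal ((2 * radius (N + 1)) ^ (1 + 1 / (β + 1)) +
        2 * Real.exp (-2 * N * radius (N + 1) ^ 2))) := by
  set c := ceThreshold (N + 1) b
  set r := radius (N + 1)
  have hr : 0 < r := radius_pos (by omega)
  have hN : (0 : ℝ) < ((N + 1 : ℕ) : ℝ) := by positivity
  have hbN' : (b : ℝ) / ((N + 1 : ℕ) : ℝ) ≤ 1 := by
    rw [div_le_one hN]; exact_mod_cast hbN.trans (Nat.le_succ N)
  have hb0 : (0 : ℝ) ≤ (b : ℝ) / ((N + 1 : ℕ) : ℝ) := by positivity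
  have hc0 : 0 ≤ c := by simp only [c, ceThreshold]; linarith
  have hc1 : c ≤ 1 := by simp only [c, ceThreshold]; linarith
  obtain ⟨i, hi1, hi2⟩ := hg.exists_cluster hc0 (r := r) fun j => by
    by_contra! h
    have : j ∈ nearGaps g (N + 1) b := mem_nearGaps.2 h
    rw [hfar] at this
    exact this
  have hl1 : c - r ≤ max (c - r) 0 := le_max_left _ _
  have hh1 : min (c + r) 1 ≤ c + r := min_le_left _ _
  have hlc : max (c - r) 0 ≤ c := max_le (by linarith) hc0
  have hch : c ≤ min (c + r) 1 := le_min (by linarith) hc1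
  refine (hasStepBound_of_window (quantileExt_mono hP) (fun x => (quantileExt_mem hP x).1)
    (fun x => (quantileExt_mem hP x).2) hb1 hbN (l := max (c - r) 0) (c := c)
    (h := min (c + r) 1) (K := (2 * r) ^ (1 / (β + 1))) (s := r) (le_max_right _ _) hlc hch
    (min_le_right _ _) (by positivity) hr.le ?_ ?_ ?_ ?_).mono ?_
  · exact (le_total (c - r) 0).symm.imp (fun h => (max_eq_left h).le) fun h => max_eq_right h
  · exact (le_total (c + r) 1).imp (fun h => (min_eq_left h).ge) fun h => min_eq_right h
  · exact hg.sub_le hβ hi1 (hch.trans hi2) (by linarith)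
  · exact hg.sub_le hβ (hi1.trans hlc) hi2 (by linarith)
  · exact ENNReal.ofReal_le_ofReal (add_le_add_left (rpow_mul_le hr (by linarith)) _)

lemma hasStepBound_near (hP : P (Set.Icc (0 : ℝ) 1) = 1) (hg : IsGapQuantiles P β ε₀ g)
    (hβ : 0 ≤ β) {ρ : ℝ} (hρ : 0 ≤ ρ * ε₀) {N b : ℕ} (hb1 : 1 ≤ b) (hbN : b ≤ N)
    (hr2 : radius (N + 1) ≤ (1 - ρ) * ε₀) {j : Fin n} (hj : j ∈ nearGaps g (N + 1) b) :
    HasStepBound (quantileExt P) N (innerGap g j) b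
      (ENNReal.ofReal ((2 * radius (N + 1)) ^ (1 + 1 / (β + 1)) +
        2 * (Real.exp (-2 * N * radius (N + 1) ^ 2) + Real.exp (-2 * N * (ρ * ε₀) ^ 2)))) := by
  rw [mem_nearGaps] at hj
  set c := ceThreshold (N + 1) b
  set r := radius (N + 1)
  set q := innerGap g j
  have hr : 0 < r := radius_pos (by omega)
  obtain ⟨hj1, hj2⟩ := abs_lt.1 hj
  -- Since `|c - q| < r ≤ (1 - ρ) * ε₀`, a window of radius at most `ρ * ε₀` around `c` stays within
  -- `ε₀` of the gap `q`, hence inside its two adjacent clusters. It is then enlarged to contain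
  -- `q`, the actual threshold.
  set s := min r (ρ * ε₀)
  have hs0 : 0 ≤ s := le_min hr.le hρ
  have hsr : s ≤ r := min_le_left _ _
  have hsρ : s ≤ ρ * ε₀ := min_le_right _ _
  have hprev : g j.castSucc.castSucc + ε₀ ≤ q := by
    have := hg.size j.castSucc
    change _ ≤ q - _ at this
    linarith
  have hnext : q + ε₀ ≤ g j.succ.succ := by
    have := hg.size j.succ
    change _ ≤ _ - q at this
    linarith
  have hl : g j.castSucc.castSucc ≤ min (c - s) q := le_min (by linarith) (by nlinarith)
  have hh : max (c + s) q ≤ g j.succ.succ := max_le (by linarith) (by nlinarith)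
  have hw1 : q - min (c - s) q ≤ 2 * r := by
    rw [sub_le_comm]; exact le_min (by linarith) (by linarith)
  have hw2 : max (c + s) q ≤ q + 2 * r := max_le (by linarith) (by linarith)
  have hw3 : max (c + s) q ≤ min (c - s) q + 2 * r :=
    max_le (by rw [← sub_le_iff_le_add]; exact le_min (by linarith) (by linarith))
      (by rw [← sub_le_iff_le_add]; exact le_min (by linarith) (by linarith))
  refine (hasStepBound_of_window (quantileExt_mono hP) (fun x => (quantileExt_mem hP x).1)
    (fun x => (quantileExt_mem hP x).2) hb1 hbN (l := min (c - s) q) (c := q)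
    (h := max (c + s) q) (K := (2 * r) ^ (1 / (β + 1))) (s := s)
    ((hg.mem_Icc _).1.trans hl) (min_le_right _ _) (le_max_right _ _)
    (hh.trans (hg.mem_Icc _).2) (by positivity) hs0 (Or.inl (min_le_left _ _))
    (Or.inl (le_max_left _ _)) ?_ ?_).mono ?_
  · exact hg.sub_le hβ (i := j.castSucc) hl le_rfl hw1
  · exact hg.sub_le hβ (i := j.succ) le_rfl hh (by linarith)
  · refine ENNReal.ofReal_le_ofReal (add_le_add (rpow_mul_le hr (by linarith)) ?_)
    refine mul_le_mul_of_nonneg_left ?_ zero_le_two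
    rcases min_choice r (ρ * ε₀) with h | h
    · rw [show s = r from h]; linarith [Real.exp_pos (-2 * N * (ρ * ε₀) ^ 2)]
    · rw [show s = ρ * ε₀ from h]; linarith [Real.exp_pos (-2 * N * r ^ 2)]

/-- The bound for the loss of the decision on a candidate who has `N` successors. -/
noncomputable def stepBound (β δ : ℝ) (n N : ℕ) : ℝ :=
  if N = 0 then 0 else (2 * radius (N + 1)) ^ (1 + 1 / (β + 1)) +
    2 * Real.exp (-2 * N * radius (N + 1) ^ 2) +
    if n = 0 then 0 else 2 * Real.exp (-2 * N * δ ^ 2)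

lemma stepBound_nonneg (β δ : ℝ) (n N : ℕ) : 0 ≤ stepBound β δ n N := by
  have := radius_nonneg (N + 1)
  unfold stepBound
  split_ifs <;> positivity

lemma hasStepBound_cwg (hP : P (Set.Icc (0 : ℝ) 1) = 1) (hg : IsGapQuantiles P β ε₀ g)
    (hβ : 0 ≤ β) {p : ℕ → ℕ → ℝ} (hp : IsCwGThreshold g p) {ρ : ℝ} (hρ : 0 < ρ * ε₀) {N : ℕ}
    (hr : 0 < n → radius (N + 1) ≤ (1 - ρ) * ε₀) (b : ℕ) :
    HasStepBound (quantileExt P) N (p (N + 1) b) b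
      (ENNReal.ofReal (stepBound β (ρ * ε₀) n N)) := by
  rcases Nat.eq_zero_or_pos b with rfl | hb
  · exact (hasStepBound_zero_budget _ _ _).mono zero_le
  obtain ⟨hp1, hp2⟩ := hp (N + 1) b
  rcases lt_or_ge N b with hNb | hbN
  · refine (hasStepBound_large_budget (fun x => (quantileExt_mem hP x).1) hNb ?_).mono zero_le
    have hce : ceThreshold (N + 1) b ≤ 0 := by
      rw [ceThreshold, sub_nonpos, one_le_div (by positivity)]
      exact_mod_cast hNb
    rw [hp1 ?_]
    · exact hce
    -- Every interior gap quantile is at least `ε₀`, which exceeds the radius, while the certainty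
    -- equivalent threshold is at most `0`; so no gap is near and everybody is hired.
    · refine Set.eq_empty_of_forall_notMem fun j hj => ?_
      have h1 := (abs_lt.1 (mem_nearGaps.1 hj)).1
      have h2 := hr j.pos
      have h3 := hg.size j.castSucc
      have h4 := (hg.mem_Icc j.castSucc.castSucc).1
      change _ ≤ innerGap g j - _ at h3
      linarith
  · have hN : N ≠ 0 := by omega
    rcases Set.eq_empty_or_nonempty (nearGaps g (N + 1) b) with he | hne
    · rw [hp1 he]
      refine (hasStepBound_far hP hg hβ hb hbN he).mono (ENNReal.ofReal_le_ofReal ?_)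
      rw [stepBound, if_neg hN]
      refine le_add_of_nonneg_right ?_
      split_ifs <;> positivity
    · obtain ⟨j, hj, _, hpj⟩ := hp2 hne
      rw [hpj]
      refine (hasStepBound_near hP hg hβ hρ.le hb hbN (hr j.pos) hj).mono
        (ENNReal.ofReal_le_ofReal (le_of_eq ?_))
      rw [stepBound, if_neg hN, if_neg j.pos.ne']
      ring

end Clustered

/-! ### Summing the losses -/

/-- Bernoulli's inequality gives `x ^ a - (x - 1) ^ a ≥ a * x ^ (a - 1)`, which telescopes. -/
lemma sum_rpow_neg_le {a : ℝ} (ha0 : 0 < a) (ha1 : a ≤ 1) (T : ℕ) :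
    ∑ N ∈ Finset.range T, ((N + 1 : ℕ) : ℝ) ^ (a - 1) ≤ (T : ℝ) ^ a / a := by
  induction T with
  | zero => simp [Real.zero_rpow ha0.ne']
  | succ T ih =>
    rw [Finset.sum_range_succ]
    set x : ℝ := ((T + 1 : ℕ) : ℝ)
    have hx : 0 < x := by positivity
    have hT : (T : ℝ) = x * (1 + -x⁻¹) := by
      simp only [x]; push_cast; field_simp; ring
    have hx1 : x⁻¹ ≤ 1 := inv_le_one_of_one_le₀ (by simp [x])
    have h1 : (T : ℝ) ^ a ≤ x ^ a * (1 + a * -x⁻¹) := by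
      rw [hT, Real.mul_rpow hx.le (by linarith)]
      exact mul_le_mul_of_nonneg_left
        (rpow_one_add_le_one_add_mul_self (by linarith) ha0.le ha1) (by positivity)
    have h2 : x ^ (a - 1) = x ^ a * x⁻¹ := by
      rw [Real.rpow_sub_one hx.ne', div_eq_mul_inv]
    rw [le_div_iff₀ ha0] at ih ⊢
    rw [h2]
    nlinarith

lemma sum_one_div_le_log {T : ℕ} (hT : 1 ≤ T) :
    ∑ N ∈ Finset.range T, (if N = 0 then 0 else 1 / ((N + 1 : ℕ) : ℝ)) ≤ Real.log T := by
  induction T, hT using Nat.le_induction with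
  | base => simp
  | succ T hT ih =>
    rw [Finset.sum_range_succ, if_neg (by omega)]
    have hT' : (0 : ℝ) < T := by exact_mod_cast hT
    have hT1 : (0 : ℝ) < ((T + 1 : ℕ) : ℝ) := by positivity
    have h := Real.log_le_sub_one_of_pos (div_pos hT' hT1)
    rw [Real.log_div hT'.ne' hT1.ne'] at h
    have : (T : ℝ) / ((T + 1 : ℕ) : ℝ) = 1 - 1 / ((T + 1 : ℕ) : ℝ) := by
      push_cast; field_simp; ring
    linarith

lemma sum_one_div_sq_le {T : ℕ} (hT : 1 ≤ T) :
    ∑ N ∈ Finset.range T, (if N = 0 then 0 else 1 / ((N + 1 : ℕ) : ℝ) ^ 2) ≤ 1 - 1 / (T : ℝ) := by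
  induction T, hT using Nat.le_induction with
  | base => simp
  | succ T hT ih =>
    rw [Finset.sum_range_succ, if_neg (by omega)]
    have hT' : (0 : ℝ) < T := by exact_mod_cast hT
    have : 1 / ((T + 1 : ℕ) : ℝ) ^ 2 ≤ 1 / (T : ℝ) - 1 / ((T + 1 : ℕ) : ℝ) := by
      push_cast
      rw [div_sub_div _ _ hT'.ne' (by positivity), div_le_div_iff₀ (by positivity) (by positivity)]
      nlinarith
    linarith

lemma rpow_two_radius_le {β : ℝ} (hβ : 0 ≤ β) {N T : ℕ} (hN : N < T) :
    (2 * radius (N + 1)) ^ (1 + 1 / (β + 1)) ≤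
      8 * Real.log T ^ ((1 : ℝ) / 2 + 1 / (2 * (β + 1))) *
        ((N + 1 : ℕ) : ℝ) ^ (-((1 : ℝ) / 2 + 1 / (2 * (β + 1)))) := by
  set s := (1 : ℝ) / 2 + 1 / (2 * (β + 1))
  have hβ1 : 1 / (2 * (β + 1)) ≤ 1 / 2 := by
    rw [div_le_div_iff₀ (by positivity) (by positivity)]; linarith
  have hs0 : 0 ≤ s := by positivity
  have hs1 : s ≤ 1 := by simp only [s]; linarith
  have hx : (0 : ℝ) < ((N + 1 : ℕ) : ℝ) := by positivity
  have hlog : Real.log ((N + 1 : ℕ) : ℝ) ≤ Real.log T :=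
    Real.log_le_log hx (by exact_mod_cast hN)
  have hlog0 : 0 ≤ Real.log ((N + 1 : ℕ) : ℝ) := Real.log_natCast_nonneg _
  -- The exponent is twice `s`, and squaring removes the root in `radius`.
  have he : 1 + 1 / (β + 1) = (2 : ℕ) * s := by
    simp only [s]; push_cast; field_simp
  have hsq : (2 * radius (N + 1)) ^ 2 = 8 * Real.log ((N + 1 : ℕ) : ℝ) * ((N + 1 : ℕ) : ℝ)⁻¹ := by
    rw [mul_pow, radius_sq]; ring
  rw [he, Real.rpow_natCast_mul (mul_nonneg zero_le_two (radius_nonneg _)), hsq,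
    Real.mul_rpow (by positivity) (by positivity), Real.mul_rpow (by norm_num) hlog0,
    Real.inv_rpow hx.le, ← Real.rpow_neg hx.le]
  have h8 : (8 : ℝ) ^ s ≤ 8 := by
    calc (8 : ℝ) ^ s ≤ 8 ^ (1 : ℝ) := Real.rpow_le_rpow_of_exponent_le (by norm_num) hs1
      _ = 8 := Real.rpow_one 8
  gcongr

lemma exp_radius_le {N : ℕ} (hN : N ≠ 0) :
    Real.exp (-2 * N * radius (N + 1) ^ 2) ≤ 1 / ((N + 1 : ℕ) : ℝ) ^ 2 := by
  have hx : (0 : ℝ) < ((N + 1 : ℕ) : ℝ) := by positivity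
  have hN1 : (1 : ℝ) ≤ N := by exact_mod_cast Nat.one_le_iff_ne_zero.2 hN
  have hlog : 0 ≤ Real.log ((N + 1 : ℕ) : ℝ) := Real.log_natCast_nonneg _
  have h : 1 / ((N + 1 : ℕ) : ℝ) ^ 2 = Real.exp (-2 * Real.log ((N + 1 : ℕ) : ℝ)) := by
    rw [show -2 * Real.log ((N + 1 : ℕ) : ℝ) = -(Real.log ((N + 1 : ℕ) : ℝ) * (2 : ℕ)) by
      push_cast; ring, Real.exp_neg, Real.exp_mul, Real.exp_log hx, Real.rpow_natCast, one_div]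
  rw [h, radius_sq, Real.exp_le_exp]
  have : (1 : ℝ) / 2 ≤ N / ((N + 1 : ℕ) : ℝ) := by
    rw [div_le_div_iff₀ two_pos hx]; push_cast; linarith
  calc -2 * (N : ℝ) * (2 * (Real.log ((N + 1 : ℕ) : ℝ) / ((N + 1 : ℕ) : ℝ)))
      = -4 * Real.log ((N + 1 : ℕ) : ℝ) * (N / ((N + 1 : ℕ) : ℝ)) := by ring
    _ ≤ _ := by nlinarith

/-- The bound on the regret coming from the cluster density. -/
noncomputable def densityTerm (β : ℝ) (T : ℕ) : ℝ :=
  if 0 < β then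
    16 * (1 + 1 / β) * Real.log T ^ ((1 : ℝ) / 2 + 1 / (2 * (β + 1)))
      * (T : ℝ) ^ ((1 : ℝ) / 2 - 1 / (2 * (β + 1)))
  else 8 * Real.log T ^ 2

lemma sum_rpow_two_radius_le {β : ℝ} (hβ : 0 ≤ β) {T : ℕ} (hT : 1 ≤ T) :
    ∑ N ∈ Finset.range T,
      (if N = 0 then 0 else (2 * radius (N + 1)) ^ (1 + 1 / (β + 1))) ≤ densityTerm β T := by
  have hlog : 0 ≤ Real.log T := Real.log_natCast_nonneg T
  rcases hβ.lt_or_eq with hβ' | rfl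
  · rw [densityTerm, if_pos hβ']
    set s := (1 : ℝ) / 2 + 1 / (2 * (β + 1)) with hs
    have ha : (1 : ℝ) / 2 - 1 / (2 * (β + 1)) = β / (2 * (β + 1)) := by field_simp; ring
    rw [ha]
    set a := β / (2 * (β + 1))
    have hsa : -s = a - 1 := by rw [← ha, hs]; ring
    have ha0 : 0 < a := by positivity
    have ha1 : a ≤ 1 := by
      simp only [a]; rw [div_le_one (by positivity)]; linarith
    calc _ ≤ ∑ N ∈ Finset.range T, 8 * Real.log T ^ s * ((N + 1 : ℕ) : ℝ) ^ (a - 1) := by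
          refine Finset.sum_le_sum fun N hN => ?_
          split_ifs
          · positivity
          · rw [← hsa]; exact rpow_two_radius_le hβ (Finset.mem_range.1 hN)
      _ = 8 * Real.log T ^ s * ∑ N ∈ Finset.range T, ((N + 1 : ℕ) : ℝ) ^ (a - 1) := by
          rw [Finset.mul_sum]
      _ ≤ 8 * Real.log T ^ s * ((T : ℝ) ^ a / a) := by
          gcongr; exact sum_rpow_neg_le ha0 ha1 T
      -- Here `1 / a = 2 * (1 + 1 / β)`, the source of the factor `16 * (1 + 1 / β)` in
      -- `densityTerm`.
      _ = _ := by
          simp only [a]; field_simp; ring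
  · rw [densityTerm, if_neg (lt_irrefl _)]
    calc _ ≤ ∑ N ∈ Finset.range T,
          8 * Real.log T * (if N = 0 then 0 else 1 / ((N + 1 : ℕ) : ℝ)) := by
          refine Finset.sum_le_sum fun N hN => ?_
          split_ifs
          · simp
          · have := rpow_two_radius_le le_rfl (Finset.mem_range.1 hN)
            norm_num at this ⊢
            rw [Real.rpow_neg_one] at this
            exact this
      _ = 8 * Real.log T * ∑ N ∈ Finset.range T, (if N = 0 then 0 else 1 / ((N + 1 : ℕ) : ℝ)) := by
          rw [Finset.mul_sum]
      _ ≤ 8 * Real.log T * Real.log T := by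
          gcongr; exact sum_one_div_le_log hT
      _ = _ := by ring

lemma sum_exp_radius_le {T : ℕ} (hT : 1 ≤ T) :
    ∑ N ∈ Finset.range T, (if N = 0 then 0 else 2 * Real.exp (-2 * N * radius (N + 1) ^ 2)) ≤
      5 * Real.log T ^ 2 := by
  rcases hT.eq_or_lt with rfl | hT2
  · simp
  · have h2 : Real.log 2 ≤ Real.log T := Real.log_le_log two_pos (by exact_mod_cast hT2)
    have h3 := Real.log_two_gt_d9
    calc _ ≤ ∑ N ∈ Finset.range T, 2 * (if N = 0 then 0 else 1 / ((N + 1 : ℕ) : ℝ) ^ 2) := by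
          refine Finset.sum_le_sum fun N _ => ?_
          split_ifs with h
          · simp
          · exact mul_le_mul_of_nonneg_left (exp_radius_le h) zero_le_two
      _ = 2 * ∑ N ∈ Finset.range T, (if N = 0 then 0 else 1 / ((N + 1 : ℕ) : ℝ) ^ 2) := by
          rw [Finset.mul_sum]
      _ ≤ 2 * (1 - 1 / (T : ℝ)) := by gcongr; exact sum_one_div_sq_le hT
      _ ≤ 2 := by have : (0 : ℝ) ≤ 1 / T := by positivity
                  linarith
      -- For `T ≥ 2` a constant is absorbed by the logarithm: `5 * (log 2)² > 2`.
      _ ≤ _ := by nlinarith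

/-- Since `log x / x` decreases on `[e, ∞)`, it suffices to take `τ₀ = 16 L / ε²`. Then `log τ₀ =
log (16 L) + 2 L` is at most `4 L + 3 log 2 - 1`, and `1.08` bounds `3 log 2 - 1`. -/
lemma radius_sq_le {ε : ℝ} (hε : 0 < ε) (hε2 : ε ≤ 1 / 2) {τ : ℕ}
    (hτ : 16 * Real.log (1 / ε) / ε ^ 2 < τ) :
    radius τ ^ 2 ≤ (1 / 2 + 1.08 / (8 * Real.log (1 / ε))) * ε ^ 2 := by
  set L := Real.log (1 / ε)
  have h2 := Real.log_two_gt_d9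
  have h2' := Real.log_two_lt_d9
  have hL : Real.log 2 ≤ L := by
    refine Real.log_le_log two_pos ?_
    rw [le_div_iff₀ hε]; linarith
  have hL0 : 0 < L := by linarith
  set τ₀ := 16 * L / ε ^ 2
  have hτ0 : 0 < τ₀ := by positivity
  have hexp : Real.exp 1 ≤ τ₀ := by
    have : 16 * L ≤ τ₀ := le_div_self (by positivity) (by positivity) (by nlinarith)
    linarith [Real.exp_one_lt_d9]
  have hlogε : Real.log (ε ^ 2) = -2 * L := by
    simp only [L, Real.log_pow, one_div, Real.log_inv]; push_cast; ring
  have hlog : Real.log τ₀ ≤ 4 * L + (3 * Real.log 2 - 1) := by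
    simp only [τ₀]
    rw [Real.log_div (by positivity) (by positivity), hlogε,
      show 16 * L = 2 ^ 3 * (2 * L) by ring, Real.log_mul (by positivity) (by positivity),
      Real.log_pow]
    have := Real.log_le_sub_one_of_pos (show 0 < 2 * L by positivity)
    push_cast
    linarith
  have hanti : Real.log τ / τ ≤ Real.log τ₀ / τ₀ :=
    Real.log_div_self_antitoneOn hexp (hexp.trans hτ.le) hτ.le
  rw [radius_sq]
  calc 2 * (Real.log τ / τ) ≤ 2 * ((4 * L + 1.08) / τ₀) := by
        refine mul_le_mul_of_nonneg_left (hanti.trans ?_) zero_le_two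
        gcongr
        linarith
    _ = _ := by
        simp only [τ₀]; field_simp; ring

lemma sum_exp_le {a : ℝ} (ha : 0 < a) (ha1 : a ≤ 1 / 10) {x : ℝ} (T : ℕ) :
    ∑ N ∈ Finset.Ico ⌊x⌋₊ T, Real.exp (-a * N) ≤ 2 / a * Real.exp (-(a * x)) := by
  have he1 : Real.exp (-a) < 1 := by rw [Real.exp_lt_one_iff]; linarith
  have h1 : a / (1 + a) ≤ 1 - Real.exp (-a) := by
    have := Real.add_one_le_exp a
    rw [Real.exp_neg, div_le_iff₀ (by linarith), sub_mul, one_mul]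
    have : (Real.exp a)⁻¹ * (1 + a) ≤ 1 := by
      rw [inv_mul_le_iff₀ (Real.exp_pos a)]; linarith
    linarith
  have hx : -a * ⌊x⌋₊ ≤ a + -(a * x) := by
    nlinarith [Nat.lt_floor_add_one x]
  have hea : Real.exp a ≤ 1.2 := by
    have := Real.exp_bound_div_one_sub_of_interval ha.le (by linarith)
    refine this.trans ?_
    rw [div_le_iff₀ (by linarith)]; linarith
  calc ∑ N ∈ Finset.Ico ⌊x⌋₊ T, Real.exp (-a * N)
      = ∑ N ∈ Finset.Ico ⌊x⌋₊ T, Real.exp (-a) ^ N :=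
        Finset.sum_congr rfl fun N _ => by rw [← Real.exp_nat_mul, mul_comm]
    _ ≤ Real.exp (-a) ^ ⌊x⌋₊ / (1 - Real.exp (-a)) :=
        geom_sum_Ico_le_of_lt_one (Real.exp_pos _).le he1
    _ ≤ (Real.exp a * Real.exp (-(a * x))) / (a / (1 + a)) := by
        rw [← Real.exp_nat_mul, mul_comm, ← Real.exp_add]
        gcongr
    _ = (Real.exp a * (1 + a)) / a * Real.exp (-(a * x)) := by field_simp
    _ ≤ _ := by
        gcongr
        nlinarith

/-- In the first phase, the radius leaves a margin `ρ * ε` to the neighbouring clusters that is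
large enough for the probability of reaching them to be summable. -/
lemma exists_margin {ε : ℝ} (hε : 0 < ε) (hε2 : ε ≤ 1 / 2) : ∃ ρ : ℝ, 0 < ρ ∧
    (∀ τ : ℕ, 16 * Real.log (1 / ε) / ε ^ 2 < τ → radius τ ≤ (1 - ρ) * ε) ∧
    ∀ T : ℕ, ∑ N ∈ Finset.Ico ⌊16 * Real.log (1 / ε) / ε ^ 2⌋₊ T,
      2 * Real.exp (-2 * N * (ρ * ε) ^ 2) ≤ 900 * (Real.sqrt (Real.log (1 / ε)) / ε) := by
  set L := Real.log (1 / ε)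
  have h2 := Real.log_two_gt_d9
  have hL : Real.log 2 ≤ L := by
    refine Real.log_le_log two_pos ?_
    rw [le_div_iff₀ hε]; linarith
  have hL0 : 0 < L := by linarith
  have hexpL : Real.exp L = 1 / ε := Real.exp_log (by positivity)
  have hrad : ∀ ρ : ℝ, ρ ≤ 1 → 1 / 2 + 1.08 / (8 * L) ≤ (1 - ρ) ^ 2 →
      ∀ τ : ℕ, 16 * L / ε ^ 2 < τ → radius τ ≤ (1 - ρ) * ε := by
    intro ρ hρ h τ hτ
    refine (sq_le_sq₀ (radius_nonneg τ) (mul_nonneg (by linarith) hε.le)).1 ?_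
    rw [mul_pow]
    exact (radius_sq_le hε hε2 hτ).trans (mul_le_mul_of_nonneg_right h (sq_nonneg ε))
  have hsum : ∀ ρ : ℝ, 0 < ρ → ρ ≤ 0.4 → ∀ T : ℕ, ∑ N ∈ Finset.Ico ⌊16 * L / ε ^ 2⌋₊ T,
      2 * Real.exp (-2 * N * (ρ * ε) ^ 2) ≤
        2 / ρ ^ 2 * (1 / ε * (1 / ε * Real.exp (-(32 * ρ ^ 2 * L)))) := by
    intro ρ hρ hρ' T
    have ha : 2 * (ρ * ε) ^ 2 ≤ 1 / 10 := by
      have : ρ * ε ≤ 0.4 * (1 / 2) := by gcongr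
      have : 0 < ρ * ε := by positivity
      nlinarith
    have := sum_exp_le (a := 2 * (ρ * ε) ^ 2) (by positivity) ha (x := 16 * L / ε ^ 2) T
    rw [← Finset.mul_sum]
    have e1 : 2 * (ρ * ε) ^ 2 * (16 * L / ε ^ 2) = 32 * ρ ^ 2 * L := by field_simp; ring
    rw [e1] at this
    calc _ = 2 * ∑ N ∈ Finset.Ico ⌊16 * L / ε ^ 2⌋₊ T, Real.exp (-(2 * (ρ * ε) ^ 2) * N) := by
          congr 1
          exact Finset.sum_congr rfl fun N _ => by congr 1; ring
      _ ≤ 2 * (2 / (2 * (ρ * ε) ^ 2) * Real.exp (-(32 * ρ ^ 2 * L))) := by gcongr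
      _ = _ := by field_simp
  have hsqrt : 0.8 ≤ Real.sqrt L := Real.le_sqrt_of_sq_le (by norm_num; linarith)
  have hfin : 1 / ε ≤ 1.25 * (Real.sqrt L / ε) := by
    rw [← mul_div_assoc]; gcongr; linarith
  -- Two demands compete: `(1 - ρ)²` must exceed `1/2 + 1.08 / (8 L)`, and `exp (-32 ρ² L)` must
  -- cancel one factor `1 / ε = exp L`. For `L ≥ 2`, `ρ = 0.24` meets both, as `32 ρ² > 1`. For
  -- smaller `L` a smaller `ρ` is needed, and incomplete cancellation costs only a constant because
  -- `L` is bounded.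
  rcases le_or_gt 2 L with hL2 | hL2
  · refine ⟨0.24, by norm_num, hrad _ (by norm_num) ?_, fun T => ?_⟩
    · have : 1.08 / (8 * L) ≤ 1.08 / 16 := by gcongr; linarith
      norm_num at this ⊢
      linarith
    · refine (hsum 0.24 (by norm_num) (by norm_num) T).trans ?_
      have : 1 / ε * Real.exp (-(32 * 0.24 ^ 2 * L)) ≤ 1 := by
        rw [← hexpL, ← Real.exp_add, Real.exp_le_one_iff]
        norm_num
        linarith
      calc _ ≤ 2 / (0.24 : ℝ) ^ 2 * (1 / ε * 1) := by gcongr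
        _ ≤ 2 / (0.24 : ℝ) ^ 2 * (1.25 * (Real.sqrt L / ε)) := by rw [mul_one]; gcongr
        _ ≤ _ := by
          rw [← mul_assoc]
          gcongr
          norm_num
  · refine ⟨0.16, by norm_num, hrad _ (by norm_num) ?_, fun T => ?_⟩
    · have : 1.08 / (8 * L) ≤ 1.08 / (8 * 0.6931) := by gcongr; linarith
      norm_num at this ⊢
      linarith
    · refine (hsum 0.16 (by norm_num) (by norm_num) T).trans ?_
      have h8 : 1 / ε * Real.exp (-(32 * 0.16 ^ 2 * L)) ≤ 5 := by
        rw [← hexpL, ← Real.exp_add]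
        calc Real.exp (L + -(32 * 0.16 ^ 2 * L)) ≤ Real.exp 1 :=
              Real.exp_le_exp.2 (by norm_num; linarith)
          _ ≤ 5 := by linarith [Real.exp_one_lt_d9]
      calc _ ≤ 2 / (0.16 : ℝ) ^ 2 * (1 / ε * 5) := by gcongr
        _ ≤ 2 / (0.16 : ℝ) ^ 2 * (1.25 * (Real.sqrt L / ε) * 5) := by gcongr
        _ = (2 / (0.16 : ℝ) ^ 2 * 1.25 * 5) * (Real.sqrt L / ε) := by ring
        _ ≤ _ := by
          gcongr
          norm_num

lemma IsGapQuantiles.le_half {P : Measure ℝ} {β ε₀ : ℝ} {n : ℕ} {g : Fin (n + 2) → ℝ}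
    (hg : IsGapQuantiles P β ε₀ g) (hn : 0 < n) : ε₀ ≤ 1 / 2 := by
  have h1 := hg.size (⟨0, hn⟩ : Fin n).castSucc
  have h2 := hg.size (⟨0, hn⟩ : Fin n).succ
  have h3 := (hg.mem_Icc (⟨0, hn⟩ : Fin n).castSucc.castSucc).1
  have h4 := (hg.mem_Icc (⟨0, hn⟩ : Fin n).succ.succ).2
  rw [Fin.succ_castSucc] at h1
  linarith

lemma sum_Ico_le_sum_range {F : ℕ → ℝ} (hF : ∀ N, 0 ≤ F N) (m T : ℕ) :
    ∑ N ∈ Finset.Ico m T, F N ≤ ∑ N ∈ Finset.range T, F N :=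
  Finset.sum_le_sum_of_subset_of_nonneg
    (fun _ hN => Finset.mem_range.2 (Finset.mem_Ico.1 hN).2) fun N _ _ => hF N

lemma sum_stepBound_le {β : ℝ} (hβ : 0 ≤ β) (δ : ℝ) (n : ℕ) {m T : ℕ} (hT : 1 ≤ T) {R : ℝ}
    (hR : 0 ≤ R)
    (hδ : 0 < n → ∑ N ∈ Finset.Ico m T, 2 * Real.exp (-2 * N * δ ^ 2) ≤ R) :
    ∑ N ∈ Finset.Ico m T, stepBound β δ n N ≤ densityTerm β T + 5 * Real.log T ^ 2 + R := by
  have hle : ∀ N, stepBound β δ n N ≤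
      (if N = 0 then 0 else (2 * radius (N + 1)) ^ (1 + 1 / (β + 1))) +
      (if N = 0 then 0 else 2 * Real.exp (-2 * N * radius (N + 1) ^ 2)) +
      (if n = 0 then 0 else 2 * Real.exp (-2 * N * δ ^ 2)) := by
    intro N
    unfold stepBound
    split_ifs <;> simp; positivity
  refine (Finset.sum_le_sum fun N _ => hle N).trans ?_
  rw [Finset.sum_add_distrib, Finset.sum_add_distrib]
  refine add_le_add (add_le_add ?_ ?_) ?_
  · refine (sum_Ico_le_sum_range (fun N => ?_) m T).trans (sum_rpow_two_radius_le hβ hT)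
    have := radius_nonneg (N + 1)
    split_ifs <;> positivity
  · refine (sum_Ico_le_sum_range (fun N => ?_) m T).trans (sum_exp_radius_le hT)
    split_ifs <;> positivity
  · rcases Nat.eq_zero_or_pos n with hn | hn
    · simpa [hn] using hR
    · simpa only [hn.ne', if_false] using hδ hn

theorem regret_cwg_le_densityTerm {β ε₀ : ℝ} (hβ : 0 ≤ β) (hε₀ : 0 < ε₀) (hε₁ : ε₀ ≤ 1)
    {P : Measure ℝ} [IsProbabilityMeasure P] (hP : P (Set.Icc (0 : ℝ) 1) = 1)
    {n : ℕ} {g : Fin (n + 2) → ℝ} (hg : IsGapQuantiles P β ε₀ g)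
    {p : ℕ → ℕ → ℝ} (hp : IsCwGThreshold g p) {T : ℕ} (hT : 1 ≤ T) (B : ℕ) :
    regret P T B (cwg P ε₀ p T B) ≤ densityTerm β T + 5 * Real.log T ^ 2 +
      904 * (Real.sqrt (Real.log (1 / ε₀)) / ε₀) := by
  set L := Real.log (1 / ε₀)
  have hL : 0 ≤ L := Real.log_nonneg (by rw [le_div_iff₀ hε₀]; linarith)
  set M := ⌊16 * L / ε₀ ^ 2⌋₊ with hM
  set k := phaseOne T ε₀
  have hk : k = T - M := rfl
  set m := T - k
  have hmk : m + k = T := by omega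
  have hmM : m ≤ M := by omega
  have hQ : 0 ≤ Real.sqrt L / ε₀ := by positivity
  obtain ⟨ρ, hρ, hrad, hsum⟩ : ∃ ρ : ℝ, 0 < ρ ∧
      (0 < n → ∀ τ : ℕ, 16 * L / ε₀ ^ 2 < τ → radius τ ≤ (1 - ρ) * ε₀) ∧
      (0 < n → ∑ N ∈ Finset.Ico M T, 2 * Real.exp (-2 * N * (ρ * ε₀) ^ 2) ≤
        900 * (Real.sqrt L / ε₀)) := by
    rcases Nat.eq_zero_or_pos n with hn | hn
    · exact ⟨1, one_pos, fun h => absurd h (by omega), fun h => absurd h (by omega)⟩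
    · obtain ⟨ρ, h1, h2, h3⟩ := exists_margin hε₀ (hg.le_half hn)
      exact ⟨ρ, h1, fun _ => h2, fun _ => h3 T⟩
  have hIco : Finset.Ico m T ⊆ Finset.Ico M T := by
    intro N hN
    rw [Finset.mem_Ico] at hN ⊢
    omega
  have hdens : ∑ N ∈ Finset.Ico m T, stepBound β (ρ * ε₀) n N ≤
      densityTerm β T + 5 * Real.log T ^ 2 + 900 * (Real.sqrt L / ε₀) :=
    sum_stepBound_le hβ _ n hT (by positivity) fun hn =>
      (Finset.sum_le_sum_of_subset_of_nonneg hIco fun _ _ _ => by positivity).trans (hsum hn)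
  have hsqrt : Real.sqrt m ≤ 4 * (Real.sqrt L / ε₀) := by
    refine Real.sqrt_le_iff.2 ⟨by positivity, ?_⟩
    have h1 : (M : ℝ) ≤ 16 * L / ε₀ ^ 2 := Nat.floor_le (by positivity)
    have h2 : (m : ℝ) ≤ M := by exact_mod_cast hmM
    refine (h2.trans h1).trans (le_of_eq ?_)
    rw [mul_pow, div_pow, Real.sq_sqrt hL]
    ring
  have hstep : ∀ N, m ≤ N → N < m + k → ∀ b, HasStepBound (quantileExt P) N (p (N + 1) b) b
      (ENNReal.ofReal (stepBound β (ρ * ε₀) n N)) := by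
    intro N h1 h2 b
    refine hasStepBound_cwg hP hg hβ hp (by positivity) (fun hn => hrad hn _ ?_) b
    -- A nonempty first phase forces `m = M`, so `N + 1` strictly exceeds the floor `M`.
    refine Nat.lt_of_floor_lt ?_
    rw [← hM]
    omega
  have hloss := lintegral_twoPhaseLoss_le (quantileExt_mono hP)
    (fun x => (quantileExt_mem hP x).1) (fun x => (quantileExt_mem hP x).2) hstep B
  rw [hmk] at hloss
  have hsum0 : 0 ≤ ∑ N ∈ Finset.Ico m T, stepBound β (ρ * ε₀) n N :=
    Finset.sum_nonneg fun N _ => stepBound_nonneg _ _ _ _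
  refine regret_cwg_le hP ε₀ p T B (by linarith [Real.sqrt_nonneg m]) (hloss.trans ?_)
  rw [← ENNReal.ofReal_sum_of_nonneg fun N _ => stepBound_nonneg _ _ _ _,
    ← ENNReal.ofReal_add hsum0 (Real.sqrt_nonneg _)]
  exact ENNReal.ofReal_le_ofReal (by linarith)

end MultiSecretary

/-! ### The main theorem -/

theorem theorem3 :
    ∃ C : ℝ, ∀ (β : ℝ), 0 ≤ β → ∀ (ε₀ : ℝ), 0 < ε₀ → ε₀ ≤ 1 →
      ∀ (P : MeasureTheory.Measure ℝ), MeasureTheory.IsProbabilityMeasure P →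
        P (Set.Icc (0 : ℝ) 1) = 1 →
      ∀ (n : ℕ) (g : Fin (n + 2) → ℝ), MultiSecretary.IsGapQuantiles P β ε₀ g →
      ∀ (p : ℕ → ℕ → ℝ), MultiSecretary.IsCwGThreshold g p →
      ∀ (T B : ℕ), 1 ≤ B → B ≤ T →
        MultiSecretary.regret P T B (MultiSecretary.cwg P ε₀ p T B) ≤
          (if 0 < β then
            C * (1 + 1 / β) * Real.log T ^ ((1 : ℝ) / 2 + 1 / (2 * (β + 1)))
              * (T : ℝ) ^ ((1 : ℝ) / 2 - 1 / (2 * (β + 1)))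
          else 0)
          + C * Real.log T ^ 2
          + C * (Real.sqrt (Real.log (1 / ε₀)) / ε₀) := by
  -- `900` comes from the tails near the gaps and `4` from the second phase; the density constant
  -- `16` and, for `β = 0`, the coefficient `8 + 5` of `(log T)²` are smaller.
  refine ⟨904, fun β hβ ε₀ hε₀ hε₁ P _ hP n g hg p hp T B hB hBT => ?_⟩
  refine (MultiSecretary.regret_cwg_le_densityTerm hβ hε₀ hε₁ hP hg hp (hB.trans hBT) B).trans ?_
  refine add_le_add ?_ le_rfl
  have hlog : 0 ≤ Real.log T := Real.log_natCast_nonneg T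
  have hlog2 : 0 ≤ Real.log T ^ 2 := sq_nonneg _
  rw [MultiSecretary.densityTerm]
  split_ifs with h
  · refine add_le_add ?_ (by linarith)
    gcongr
    norm_num
  · linarith
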